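/- Let $[k]=\frac{1-q^k}{1-q}$ and, for integers $r\ge 0$, $n\geq 1$, let $$T_{r,n}(q)=\sum_{k=1}^{n}(-1)^{n-k}[k]^{r}q^{\frac r2(n-k)} .$$ There exist polynomials $G_{m,k},H_{m,k}\in\mathbb Z[q]$ ($0\le k<m$) such that, for all $m,n\ge 1$, as identities of rational functions in $q^{1/2}$, $$T_{2m,n}(q)=\sum_{k=1}^{m}(-q^n)^{m-k}\frac{G_{m,m-k}(q)}{\prod_{i=0}^{m-k}(1+q^{m-i})}([n][n+1])^k$$ and $$T_{2m-1,n}(q)=(-1)^{m+n}H_{m,m-1}(q^{\frac12})\frac{q^{(m-\frac12)n}}{(1+q^{\frac12})^{m}\prod_{i=0}^{m-1}(1+q^{m-i-\frac12})}+\frac{1-q^{n+\frac12}}{1-q^{\frac12}}\sum_{k=1}^{m}(-q^n)^{m-k}\frac{H_{m,m-k}(q^{\frac12})([n][n+1])^{k-1}}{(1+q^{\frac12})^{m-k+1}\prod_{i=0}^{m-k}(1+q^{m-i-\frac12})},$$ and any such polynomials are given as follows. Fix $0\le k<m$ and put $u_i=(2i,-2i)$, $v_i=(2i+2,\,m-k-1-i)$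 for $0\le i\le k-1$. Let $\mathcal N$ be the set of families $\mathbf L=(L_0,\dots,L_{k-1})$ of pairwise vertex-disjoint lattice paths in $\mathbb Z^2$ with steps $(1,0)$ and $(0,1)$, where $L_i$ goes from $u_i$ to $v_i$. Given weights of steps, the weight of a family is the product of the weights of all steps of all its paths. (i) $$G_{m,k}(q)=\sum_{\mathbf L\in\mathcal N}\ \sum_{I\subseteq\{0,1,\dots,k-1\}}w_I(\mathbf L),$$ where, for $w_I$, vertical steps with $x$-coordinate $2i-1$ for some $i\in I$, and vertical steps with $x$-coordinate $2i$ for some integer $i\notin I$ (in particular $i=k$), have weight $q$, and all other steps have weight $1$. (ii) $$H_{m,k}(q)=\sum_{\mathbf L\in\mathcal N}\ \sum_{I\subseteq\{0,1,\dots,k-1\}}\overline w_I(\mathbf L),$$ where the step weights for $\overline w_I$ are those for $w_I$ with $q$ replaced by $q^2$, except that for vertical steps starting at one of the points $u_0,\dots,u_{k-1}$ the number $q$ is added to the weight (so $1$ becomes $1+q$, and $q^2$ becomes $q^2+q$). -/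

import Mathlib

open Finset Polynomial

noncomputable section

/-- The `q`-integer `[k] = (1 - q ^ k) / (1 - q)`. -/
def qInt {K : Type*} [Field K] (q : K) (k : ℕ) : K := (1 - q ^ k) / (1 - q)

/-- The alternating sum
`T_{r,n}(q) = ∑_{k=1}^n (-1)^(n-k) [k]^r q^((r/2)(n-k))`, written in terms of `p = q^(1/2)`. -/
def altPowerSum {K : Type*} [Field K] (p : K) (r n : ℕ) : K :=
  ∑ k ∈ Icc 1 n, (-1) ^ (n - k) * qInt (p ^ 2) k ^ r * p ^ (r * (n - k))

/-- `G` is a family of `q`-Salié coefficients of the first kind: for all `m, n ≥ 1`,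
`T_{2m,n}(q) = ∑_{k=1}^m (-q^n)^(m-k) G_{m,m-k}(q) / (∏_{i=0}^{m-k} (1+q^(m-i))) ([n][n+1])^k`,
as an identity of rational functions in `p = q^(1/2)`. -/
def IsQSalieG (G : ℕ → ℕ → ℤ[X]) : Prop :=
  ∀ m n : ℕ, 1 ≤ m → 1 ≤ n →
    let p : RatFunc ℚ := RatFunc.X
    let q : RatFunc ℚ := p ^ 2
    altPowerSum p (2 * m) n =
      ∑ k ∈ Icc 1 m, (-q ^ n) ^ (m - k)
        * (aeval q (G m (m - k)) / ∏ i ∈ range (m - k + 1), (1 + q ^ (m - i)))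
        * (qInt q n * qInt q (n + 1)) ^ k

/-- `H` is a family of `q`-Salié coefficients of the second kind: for all `m, n ≥ 1`, with
`p = q^(1/2)`, the sum `T_{2m-1,n}(q)` is
`(-1)^(m+n) H_{m,m-1}(p) q^((m-1/2)n) / ((1+p)^m ∏_{i=0}^{m-1} (1+q^(m-i-1/2)))` plus
`(1-q^(n+1/2))/(1-p)` times
`∑_{k=1}^m (-q^n)^(m-k) H_{m,m-k}(p) ([n][n+1])^(k-1)`
`/ ((1+p)^(m-k+1) ∏_{i=0}^{m-k} (1+q^(m-i-1/2)))`,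
as an identity of rational functions in `p`. -/
def IsQSalieH (H : ℕ → ℕ → ℤ[X]) : Prop :=
  ∀ m n : ℕ, 1 ≤ m → 1 ≤ n →
    let p : RatFunc ℚ := RatFunc.X
    let q : RatFunc ℚ := p ^ 2
    altPowerSum p (2 * m - 1) n =
      (-1) ^ (m + n) * aeval p (H m (m - 1))
          * (p ^ ((2 * m - 1) * n)
            / ((1 + p) ^ m * ∏ i ∈ range m, (1 + p ^ (2 * (m - i) - 1))))
        + (1 - p ^ (2 * n + 1)) / (1 - p)
          * ∑ k ∈ Icc 1 m, (-q ^ n) ^ (m - k)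
              * (aeval p (H m (m - k)) * (qInt q n * qInt q (n + 1)) ^ (k - 1)
                / ((1 + p) ^ (m - k + 1)
                  * ∏ i ∈ range (m - k + 1), (1 + p ^ (2 * (m - i) - 1))))

/-- `s → t` is a vertical unit step `(0, 1)`. -/
def IsVertical (s t : ℤ × ℤ) : Prop := t = s + (0, 1)

/-- `s → t` is a unit step `(1, 0)` or `(0, 1)`. -/
def IsStep (s t : ℤ × ℤ) : Prop := t = s + (1, 0) ∨ IsVertical s t

/-- A lattice path from `a` to `b`: the list of its points, starting at `a`, ending at `b`,
consecutive points differing by `(1, 0)` or `(0, 1)`. -/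
@[ext] structure LatticePath (a b : ℤ × ℤ) where
  points : List (ℤ × ℤ)
  head_eq : points.head? = some a
  last_eq : points.getLast? = some b
  chain : points.IsChain IsStep

theorem finite_chains_of_length (N : ℕ) : ∀ a : ℤ × ℤ,
    {l : List (ℤ × ℤ) | l.head? = some a ∧ l.IsChain IsStep ∧ l.length = N + 1}.Finite := by
  induction N with
  | zero =>
    intro a
    refine (Set.finite_singleton [a]).subset ?_
    rintro l ⟨h1, -, h3⟩
    obtain ⟨x, rfl⟩ := List.length_eq_one_iff.1 h3
    simpa using h1
  | succ N ih =>
    intro a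
    refine (((ih (a + (1, 0))).union (ih (a + (0, 1)))).image (List.cons a)).subset ?_
    rintro l ⟨h1, h2, h3⟩
    match l, h1, h2, h3 with
    | [x], _, _, h3 => simp at h3
    | x :: y :: l, h1, h2, h3 =>
      obtain rfl : x = a := by simpa using h1
      rw [List.isChain_cons_cons] at h2
      refine ⟨y :: l, ?_, rfl⟩
      have h3' : (y :: l).length = N + 1 := by simpa using h3
      rcases h2.1 with h | h
      · exact Or.inl ⟨by simp [h], h2.2, h3'⟩
      · exact Or.inr ⟨by simp [show y = x + (0, 1) from h], h2.2, h3'⟩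

theorem length_of_chain (b : ℤ × ℤ) : ∀ (l : List (ℤ × ℤ)) (a : ℤ × ℤ), l.head? = some a →
    l.getLast? = some b → l.IsChain IsStep →
    (l.length : ℤ) = (b.1 + b.2) - (a.1 + a.2) + 1
  | [], _, h1, _, _ => by simp at h1
  | [x], a, h1, h2, _ => by
    obtain rfl : x = a := by simpa using h1
    obtain rfl : x = b := by simpa using h2
    simp
  | x :: y :: l, a, h1, h2, h3 => by
    obtain rfl : x = a := by simpa using h1
    rw [List.isChain_cons_cons] at h3
    have ih := length_of_chain b (y :: l) y rfl (by simpa using h2) h3.2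
    have hy : y.1 + y.2 = x.1 + x.2 + 1 := by
      rcases h3.1 with h | h
      · rw [h]; simp; ring
      · rw [show y = x + (0, 1) from h]; simp; ring
    rw [List.length_cons]
    push_cast
    linarith

instance (a b : ℤ × ℤ) : Finite (LatticePath a b) := by
  have hf := finite_chains_of_length (((b.1 + b.2) - (a.1 + a.2)).toNat) a
  have := hf.to_subtype
  refine Finite.of_injective (β := {l : List (ℤ × ℤ) | l.head? = some a ∧ l.IsChain IsStep ∧
    l.length = ((b.1 + b.2) - (a.1 + a.2)).toNat + 1})
    (fun L => ⟨L.points, L.head_eq, L.chain, ?_⟩) ?_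
  · have h := length_of_chain b L.points a L.head_eq L.last_eq L.chain
    have hpos : 0 < L.points.length := by
      rcases L with ⟨l, h1, h2, h3⟩
      cases l with
      | nil => simp at h1
      | cons x l => simp
    omega
  · intro L M h
    exact LatticePath.ext (congrArg Subtype.val h)

instance (a b : ℤ × ℤ) : Fintype (LatticePath a b) := Fintype.ofFinite _

/-- The weight of a path: the product of the weights `w s t` of its steps `s → t`. -/
def LatticePath.weight {R : Type*} [CommRing R] {a b : ℤ × ℤ} (w : ℤ × ℤ → ℤ × ℤ → R)
    (L : LatticePath a b) : R :=
  ((L.points.zip L.points.tail).map fun e => w e.1 e.2).prod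

/-- The starting points `u_i = (2i, -2i)`. -/
def startPt (i : ℕ) : ℤ × ℤ := (2 * i, -2 * i)

/-- The end points `v_i = (2i + 2, m - k - 1 - i)`. -/
def endPt (m k i : ℕ) : ℤ × ℤ := (2 * i + 2, m - k - 1 - i)

/-- Families of paths, the `i`-th one from `u_i` to `v_i`, for `0 ≤ i ≤ k - 1`. -/
abbrev PathFamily (m k : ℕ) : Type := (i : Fin k) → LatticePath (startPt i) (endPt m k i)

/-- No two paths of the family have a common point. -/
def PathFamily.NonIntersecting {m k : ℕ} (L : PathFamily m k) : Prop :=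
  ∀ i j : Fin k, i ≠ j → List.Disjoint (L i).points (L j).points

/-- The weight of a family of paths is the product of the weights of all its steps. -/
def PathFamily.weight {R : Type*} [CommRing R] {m k : ℕ} (w : ℤ × ℤ → ℤ × ℤ → R)
    (L : PathFamily m k) : R :=
  ∏ i : Fin k, (L i).weight w

/-- The weights of the steps for `w_I`: a vertical step on the line `x = 2i - 1` with `i ∈ I`, or
on the line `x = 2i` with `i` an integer not in `I`, has weight `q`; all other steps have
weight `1`. -/
def stepWeight {R : Type*} [CommRing R] (q : R) (I : Finset ℤ) (s t : ℤ × ℤ) : R :=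
  open Classical in
  if IsVertical s t ∧ ((∃ i ∈ I, s.1 = 2 * i - 1) ∨ ∃ i : ℤ, i ∉ I ∧ s.1 = 2 * i) then q else 1

/-- The weights of the steps for the second family: those for `w_I` with `q ^ 2` in place of `q`,
except that `q` is added to the weight of a vertical step that starts in some `u_i`,
`0 ≤ i ≤ k - 1`. -/
def stepWeightBar {R : Type*} [CommRing R] (k : ℕ) (q : R) (I : Finset ℤ) (s t : ℤ × ℤ) : R :=
  open Classical in
  stepWeight (q ^ 2) I s t + if IsVertical s t ∧ ∃ i < k, s = startPt i then q else 0

end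

/-!
The coefficients are Hessenberg determinants, and these count non-intersecting lattice paths.

Put `p = q^(1/2)`, `S = [n]^2`, `A = [n][n+1]`, `B = q[n-1][n]` and `t = q^n`. Then
`A + B = (1 + q) S` and `A B = S (q S - t)`, so that `A^k + B^k = ∑_j c(k,j) S^(k-j) t^j` with
coefficients `c(k,j)` (`powSumCoeff`) whose generating function for fixed `j` is
`(2 - (1 + q) z) / ((1 - z)(1 - q z))^(j+1)` (`pairSeries_pow_mul_mk`). The sums satisfy
`T_{r,n} + p^r T_{r,n-1} = [n]^r`. For `t_k(n) = q^(n(m-k)) A^k`, the expression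
`t_k(n) + q^m t_k(n-1)` equals `∑_l C(k,l) q^(n(m-l)) [n]^(2l)` with the lower triangular matrix
`C(k,l) = c(k,k-l)`. For odd `r = 2m - 1`, the functions
`t_k(n) = (1 - p^(2n+1)) / (1 - p) q^(n(m-k)) A^(k-1)` satisfy
`t_k(n) + p^r t_k(n-1) = ∑_l C(k,l) q^(n(m-l)) [n]^(2l-1)` with
`C(k,l) = c(k,k-l) + p c(k-1,k-l)`. Both cases are treated together by `salieMatrix q α`, with
`α = 0` or `α = p`. Hence `T` is the combination of the `t_k` whose coefficients are the last row
of `C⁻¹`, up to a multiple of `(-p^r)^n` that corrects the value for `n = 0` and is needed only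
for odd `r` (`altPowerSum_even`, `altPowerSum_odd`), and by Cramer's rule these are minors of `C` of Hessenberg shape divided by
products of diagonal entries (`row_of_inverse_mul_prod`).

On the side of the paths, the Lindström–Gessel–Viennot lemma (`disjointPathsGF_eq_det`) turns the
sum over non-intersecting families into a determinant. The columns `2i - 1` and `2i` carry the
weights `1` and `q` in an order that depends on `i ∈ I`, and the generating function of the paths
between two points does not see this order. So the row of the start `u_j` depends on `I` only
through the weight of the column `2j`, and summing over `I` adds the two possible versions of each
row (`sum_det_shiftedWeight`). The entries of the resulting matrix are those of `salieMatrix`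
(`pathGF_shiftedWeight_add`), where `α` is the extra weight of vertical steps at the starts.

The coefficients are determined by the identities: after fixing `m`, these are polynomial identities
in `x = q^n`, or in `p^n` for the odd case, at infinitely many places (`even_coeff_eq_zero`,
`odd_coeff_eq_zero`).
-/

/-! ### Lattice paths: first-step decomposition -/

/-- The end of a unit step from `a`: to the right for `true`, upwards for `false`. -/
def stepTo (e : Bool) (a : ℤ × ℤ) : ℤ × ℤ := if e then a + (1, 0) else a + (0, 1)

theorem isStep_iff {a b : ℤ × ℤ} : IsStep a b ↔ ∃ e, b = stepTo e a := by
  simp [IsStep, IsVertical, stepTo, or_comm]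

theorem isStep_stepTo (e : Bool) (a : ℤ × ℤ) : IsStep a (stepTo e a) := isStep_iff.2 ⟨e, rfl⟩

theorem stepTo_fst (e : Bool) (a : ℤ × ℤ) : (stepTo e a).1 = a.1 + if e then 1 else 0 := by
  cases e <;> simp [stepTo]

theorem stepTo_sum (e : Bool) (a : ℤ × ℤ) :
    (stepTo e a).1 + (stepTo e a).2 = a.1 + a.2 + 1 := by
  cases e <;> simp [stepTo] <;> ring

theorem stepTo_left_injective (a : ℤ × ℤ) : Function.Injective fun e => stepTo e a := by
  intro e f h
  have := congrArg Prod.fst h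
  revert this
  cases e <;> cases f <;> simp [stepTo]

namespace LatticePath

variable {a a' b : ℤ × ℤ}

theorem exists_points_eq_cons (L : LatticePath a b) : ∃ l, L.points = a :: l := by
  rcases L with ⟨l, h1, h2, h3⟩
  cases l with
  | nil => simp at h1
  | cons x l => exact ⟨l, by simpa using h1⟩

theorem start_le (L : LatticePath a b) {x : ℤ × ℤ} (hx : x ∈ L.points) : a ≤ x := by
  obtain ⟨l, hl⟩ := L.exists_points_eq_cons
  have h : L.points.IsChain (· ≤ ·) := L.chain.imp fun s t h => by
    rcases h with rfl | h
    · simp [Prod.le_def]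
    · rw [h]; simp [Prod.le_def]
  rw [List.isChain_iff_pairwise, hl, List.pairwise_cons] at h
  rw [hl, List.mem_cons] at hx
  rcases hx with rfl | hx
  · exact le_rfl
  · exact h.1 x hx

theorem start_mem (L : LatticePath a b) : a ∈ L.points := List.mem_of_head? L.head_eq

theorem end_mem (L : LatticePath a b) : b ∈ L.points := List.mem_of_getLast? L.last_eq

theorem start_le_end (L : LatticePath a b) : a ≤ b := L.start_le L.end_mem

/-- Prepend a step to a lattice path. -/
def cons (h : IsStep a a') (L : LatticePath a' b) : LatticePath a b where
  points := a :: L.points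
  head_eq := rfl
  last_eq := by
    obtain ⟨l, hl⟩ := L.exists_points_eq_cons
    have := L.last_eq
    rw [hl] at this ⊢
    simpa using this
  chain := by
    have := L.chain
    obtain ⟨l, hl⟩ := L.exists_points_eq_cons
    rw [hl] at this ⊢
    exact List.isChain_cons_cons.2 ⟨h, this⟩

theorem weight_cons {R : Type*} [CommRing R] (w : ℤ × ℤ → ℤ × ℤ → R) (h : IsStep a a')
    (L : LatticePath a' b) : (cons h L).weight w = w a a' * L.weight w := by
  obtain ⟨l, hl⟩ := L.exists_points_eq_cons
  simp [weight, cons, hl]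

/-- The path consisting of a single point. -/
def single (a : ℤ × ℤ) : LatticePath a a where
  points := [a]
  head_eq := rfl
  last_eq := rfl
  chain := List.isChain_singleton a

theorem points_eq_singleton (L : LatticePath a a) : L.points = [a] := by
  have h := length_of_chain a L.points a L.head_eq L.last_eq L.chain
  obtain ⟨l, hl⟩ := L.exists_points_eq_cons
  rw [hl] at h ⊢
  have : l.length = 0 := by
    simp only [List.length_cons] at h
    push_cast at h
    omega
  rw [List.length_eq_zero_iff.1 this]

instance (a : ℤ × ℤ) : Unique (LatticePath a a) where
  default := single a
  uniq L := LatticePath.ext (points_eq_singleton L)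

theorem weight_self {R : Type*} [CommRing R] (w : ℤ × ℤ → ℤ × ℤ → R) (L : LatticePath a a) :
    L.weight w = 1 := by
  simp [weight, points_eq_singleton L]

/-- A path between different points is its first step followed by a path. -/
noncomputable def consEquiv (h : a ≠ b) :
    (Σ e : Bool, LatticePath (stepTo e a) b) ≃ LatticePath a b :=
  Equiv.ofBijective (fun L => cons (isStep_stepTo L.1 a) L.2) <| by
    constructor
    · rintro ⟨e, L⟩ ⟨f, M⟩ hLM
      have h1 : L.points = M.points := by
        simpa [cons] using congrArg LatticePath.points hLM
      have h2 : stepTo e a = stepTo f a := by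
        have := L.head_eq.symm.trans ((congrArg List.head? h1).trans M.head_eq)
        simpa using this
      obtain rfl := stepTo_left_injective a h2
      rw [LatticePath.ext h1]
    · intro L
      obtain ⟨l, hl⟩ := L.exists_points_eq_cons
      have h2 := L.last_eq
      have h3 := L.chain
      cases l with
      | nil => rw [hl] at h2; simp at h2; exact absurd h2 h
      | cons y l =>
        rw [hl] at h2 h3
        rw [List.isChain_cons_cons] at h3
        obtain ⟨e, rfl⟩ := isStep_iff.1 h3.1
        exact ⟨⟨e, ⟨_ :: l, rfl, by simpa using h2, h3.2⟩⟩, LatticePath.ext hl.symm⟩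

end LatticePath

section LGV

variable {R : Type*} [CommRing R] (w : ℤ × ℤ → ℤ × ℤ → R)

/-- The generating function of the lattice paths from `a` to `b`. -/
noncomputable def pathGF (a b : ℤ × ℤ) : R := ∑ L : LatticePath a b, L.weight w

theorem pathGF_self (a : ℤ × ℤ) : pathGF w a a = 1 := by
  simp [pathGF, LatticePath.weight_self]

theorem pathGF_eq_zero {a b : ℤ × ℤ} (h : ¬ a ≤ b) : pathGF w a b = 0 := by
  have : IsEmpty (LatticePath a b) := ⟨fun L => h L.start_le_end⟩
  simp [pathGF]

theorem pathGF_eq_sum {a b : ℤ × ℤ} (h : a ≠ b) :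
    pathGF w a b = ∑ e : Bool, w a (stepTo e a) * pathGF w (stepTo e a) b := by
  simp only [pathGF, mul_sum]
  rw [← (LatticePath.consEquiv h).sum_comp, Fintype.sum_sigma]
  exact sum_congr rfl fun e _ => sum_congr rfl fun L _ =>
    LatticePath.weight_cons w (isStep_stepTo _ _) _

/-! ### The Lindström–Gessel–Viennot lemma -/

/-- The paths of a family have pairwise no common point. -/
def IsDisjointFamily {n : ℕ} {a b : Fin n → ℤ × ℤ} (L : ∀ i, LatticePath (a i) (b i)) : Prop :=
  ∀ i j, i ≠ j → List.Disjoint (L i).points (L j).points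

open Classical in
/-- The generating function of the families of pairwise disjoint paths from `a i` to `b i`. -/
noncomputable def disjointPathsGF {n : ℕ} (a b : Fin n → ℤ × ℤ) : R :=
  ∑ L : ∀ i, LatticePath (a i) (b i),
    if IsDisjointFamily L then ∏ i, (L i).weight w else 0

/-- Families of paths, each of which has at least one step, are families of first steps followed
by a family of paths. -/
noncomputable def familyConsEquiv {n : ℕ} {a b : Fin n → ℤ × ℤ} (h : ∀ i, a i ≠ b i) :
    (Σ ε : Fin n → Bool, ∀ i, LatticePath (stepTo (ε i) (a i)) (b i)) ≃
      ∀ i, LatticePath (a i) (b i) :=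
  Equiv.trans
    { toFun := fun L i => (⟨L.1 i, L.2 i⟩ : Σ e : Bool, LatticePath (stepTo e (a i)) (b i))
      invFun := fun L => ⟨fun i => (L i).1, fun i => (L i).2⟩
      left_inv := fun _ => rfl
      right_inv := fun _ => rfl }
    (Equiv.piCongrRight fun i => LatticePath.consEquiv (h i))

/-- Since all `a i` lie on one antidiagonal, no later point of a path is one of the `a i`. -/
theorem isDisjointFamily_cons {n : ℕ} {a b : Fin n → ℤ × ℤ} {s : ℤ}
    (ha : ∀ i, (a i).1 + (a i).2 = s) (hinj : Function.Injective a) (h : ∀ i, a i ≠ b i)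
    (ε : Fin n → Bool) (L : ∀ i, LatticePath (stepTo (ε i) (a i)) (b i)) :
    IsDisjointFamily (familyConsEquiv h ⟨ε, L⟩) ↔ IsDisjointFamily L := by
  have hp : ∀ i, (familyConsEquiv h ⟨ε, L⟩ i).points = a i :: (L i).points := fun i => rfl
  have hlt : ∀ i j, a i ∉ (L j).points := fun i j hm => by
    have h1 := (L j).start_le hm
    have h2 := stepTo_sum (ε j) (a j)
    have := h1.1
    have := h1.2
    have := ha i
    have := ha j
    omega
  unfold IsDisjointFamily
  refine forall_congr' fun i => forall_congr' fun j => imp_congr_right fun hij => ?_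
  rw [hp, hp, List.disjoint_cons_left, List.disjoint_cons_right]
  simp [hlt, hinj.ne hij]

theorem disjointPathsGF_eq_sum {n : ℕ} {a b : Fin n → ℤ × ℤ} {s : ℤ}
    (ha : ∀ i, (a i).1 + (a i).2 = s) (hinj : Function.Injective a) (h : ∀ i, a i ≠ b i) :
    disjointPathsGF w a b = ∑ ε : Fin n → Bool, (∏ i, w (a i) (stepTo (ε i) (a i))) *
      disjointPathsGF w (fun i => stepTo (ε i) (a i)) b := by
  classical
  unfold disjointPathsGF
  rw [← (familyConsEquiv h).sum_comp, Fintype.sum_sigma]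
  refine sum_congr rfl fun ε _ => ?_
  rw [mul_sum]
  refine sum_congr rfl fun L _ => ?_
  rw [mul_ite, mul_zero, ← prod_mul_distrib]
  refine if_congr (isDisjointFamily_cons ha hinj h ε L) ?_ rfl
  exact prod_congr rfl fun i _ => LatticePath.weight_cons w (isStep_stepTo _ _) _

theorem disjointPathsGF_eq_zero {n : ℕ} {a b : Fin n → ℤ × ℤ} (i : Fin n) (h : ¬ a i ≤ b i) :
    disjointPathsGF w a b = 0 := by
  have : IsEmpty (∀ i, LatticePath (a i) (b i)) := ⟨fun L => h (L i).start_le_end⟩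
  simp [disjointPathsGF]

theorem disjointPathsGF_not_injective {n : ℕ} {a b : Fin n → ℤ × ℤ}
    (h : ¬ Function.Injective a) : disjointPathsGF w a b = 0 := by
  classical
  obtain ⟨i, j, hij, hne⟩ := Function.not_injective_iff.1 h
  refine sum_eq_zero fun L _ => if_neg fun hL => ?_
  refine hL i j hne (L i).start_mem ?_
  rw [hij]
  exact (L j).start_mem

/-- A path that consists of its starting point can be dropped from the family. -/
theorem disjointPathsGF_succ {n : ℕ} {a b : Fin (n + 1) → ℤ × ℤ} {s : ℤ}
    (ha : ∀ i, (a i).1 + (a i).2 = s) (hinj : Function.Injective a) (h : a 0 = b 0) :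
    disjointPathsGF w a b = disjointPathsGF w (fun i => a i.succ) fun i => b i.succ := by
  classical
  obtain ⟨b, rfl⟩ : ∃ b' : Fin n → ℤ × ℤ, b = Fin.cons (a 0) b' :=
    ⟨Fin.tail b, by rw [h, Fin.cons_self_tail]⟩
  unfold disjointPathsGF
  rw [← (Fin.consEquiv fun i =>
    LatticePath (a i) ((Fin.cons (a 0) b : Fin (n + 1) → ℤ × ℤ) i)).sum_comp, Fintype.sum_prod_type]
  have : Unique (LatticePath (a 0) ((Fin.cons (a 0) b : Fin (n + 1) → ℤ × ℤ) 0)) :=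
    inferInstanceAs (Unique (LatticePath (a 0) (a 0)))
  rw [Fintype.sum_unique]
  refine sum_congr rfl fun L _ => ?_
  set M := Fin.consEquiv (fun i => LatticePath (a i) ((Fin.cons (a 0) b : Fin (n + 1) → ℤ × ℤ) i))
    (default, L)
  have hM0 : (M 0).points = [a 0] := LatticePath.points_eq_singleton (a := a 0) (M 0)
  have hMs : ∀ i : Fin n, M i.succ = L i := fun i => rfl
  have hnot : ∀ i : Fin n, a 0 ∉ (L i).points := fun i hm => by
    have h1 := (L i).start_le hm
    have := h1.1
    have := h1.2
    have := ha 0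
    have := ha i.succ
    have : a i.succ = a 0 := Prod.ext (by omega) (by omega)
    exact Fin.succ_ne_zero i (hinj this)
  refine if_congr
    ⟨fun H i j hij => H i.succ j.succ (by simpa using hij), fun H i j hij => ?_⟩ ?_ rfl
  · cases i using Fin.cases with
    | zero =>
      cases j using Fin.cases with
      | zero => exact absurd rfl hij
      | succ j => rw [hM0, hMs]; simpa using hnot j
    | succ i =>
      cases j using Fin.cases with
      | zero => rw [hM0, hMs]; simpa using hnot i
      | succ j => exact H i j (by simpa using hij)
  · rw [Fin.prod_univ_succ]
    have : (M 0).weight w = 1 := LatticePath.weight_self (a := a 0) w (M 0)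
    rw [this, one_mul]
    rfl

/-- Expansion of the determinant by multilinearity in the rows, each row being split according to
the first step of the path. -/
theorem det_pathGF_eq_sum {n : ℕ} {a b : Fin n → ℤ × ℤ} (h : ∀ i j, a i ≠ b j) :
    (Matrix.of fun i j => pathGF w (a i) (b j)).det =
      ∑ ε : Fin n → Bool, (∏ i, w (a i) (stepTo (ε i) (a i))) *
        (Matrix.of fun i j => pathGF w (stepTo (ε i) (a i)) (b j)).det := by
  have h1 : (Matrix.of fun i j => pathGF w (a i) (b j)) = fun i => ∑ e : Bool,
      (w (a i) (stepTo e (a i)) • fun j => pathGF w (stepTo e (a i)) (b j)) := by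
    funext i j
    rw [Finset.sum_apply]
    exact pathGF_eq_sum w (h i j)
  rw [h1]
  have h2 := (Matrix.detRowAlternating (n := Fin n) (R := R)).toMultilinearMap.map_sum
    (fun i (e : Bool) => (w (a i) (stepTo e (a i)) • fun j => pathGF w (stepTo e (a i)) (b j)))
  refine h2.trans (sum_congr rfl fun ε _ => ?_)
  exact (Matrix.detRowAlternating (n := Fin n) (R := R)).toMultilinearMap.map_smul_univ _ _

/-- The **Lindström–Gessel–Viennot lemma** for starting points on one antidiagonal, ordered from
left to right, and end points whose antidiagonals ascend and whose heights descend. Both sides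
satisfy the same recursion over simultaneous first steps of all paths: choices of steps that make
two paths collide contribute determinants with two equal rows. -/
theorem disjointPathsGF_eq_det {n : ℕ} {a b : Fin n → ℤ × ℤ} {s : ℤ}
    (ha : ∀ i, (a i).1 + (a i).2 = s) (hmono : StrictMono fun i => (a i).1)
    (hb : Monotone fun i => (b i).1 + (b i).2) (hb' : Antitone fun i => (b i).2) :
    disjointPathsGF w a b = (Matrix.of fun i j => pathGF w (a i) (b j)).det := by
  induction n generalizing s with
  | zero =>
    simp [disjointPathsGF, IsDisjointFamily]
  | succ n ih =>
    have main : ∀ d : ℕ, ∀ (a : Fin (n + 1) → ℤ × ℤ) (s : ℤ),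
        (∀ i, (a i).1 + (a i).2 = s) → (StrictMono fun i => (a i).1) →
        (b 0).1 + (b 0).2 - s = d →
        disjointPathsGF w a b = (Matrix.of fun i j => pathGF w (a i) (b j)).det := by
      intro d
      induction d with
      | zero =>
        intro a s ha hmono hd
        have hinj : Function.Injective a := fun i j hij => hmono.injective (by simp [hij])
        have hcol : ∀ i, a i ≠ b 0 → pathGF w (a i) (b 0) = 0 := fun i hi =>
          pathGF_eq_zero w fun hle => hi <| by
            have := hle.1
            have := hle.2
            have := ha i
            exact Prod.ext (by omega) (by omega)
        by_cases h0 : a 0 = b 0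
        · rw [disjointPathsGF_succ w ha hinj h0,
            ih (s := s) (fun i => ha _) (fun i j hij => hmono (Fin.succ_lt_succ_iff.2 hij))
              (fun i j hij => hb (Fin.succ_le_succ_iff.2 hij))
              (fun i j hij => hb' (Fin.succ_le_succ_iff.2 hij)),
            Matrix.det_succ_column_zero, Fin.sum_univ_succ, sum_eq_zero]
          · simp only [Matrix.of_apply, h0, pathGF_self]
            simp
            rfl
          · intro i _
            rw [Matrix.of_apply, hcol, mul_zero, zero_mul]
            rw [← h0]
            exact hinj.ne (Fin.succ_ne_zero i)
        · rw [disjointPathsGF_eq_zero w 0 fun hle => h0 <| by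
            have := hle.1
            have := hle.2
            have := ha 0
            exact Prod.ext (by omega) (by omega)]
          symm
          rcases lt_or_ge (a 0).1 (b 0).1 with hlt | hge
          -- `a 0` lies strictly above `b 0`, hence above all end points
          · refine Matrix.det_eq_zero_of_row_eq_zero 0 fun j => pathGF_eq_zero w fun hle => ?_
            have := hle.2
            have : (b j).2 ≤ (b 0).2 := hb' (Fin.zero_le j)
            have := ha 0
            omega
          · refine Matrix.det_eq_zero_of_column_eq_zero 0 fun i => hcol i fun hi => ?_
            have h1 : (a 0).1 ≤ (a i).1 := hmono.monotone (Fin.zero_le i)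
            have h2 := ha 0
            rw [hi] at h1
            exact h0 (Prod.ext (by omega) (by omega))
      | succ d ihd =>
        intro a s ha hmono hd
        have hinj : Function.Injective a := fun i j hij => hmono.injective (by simp [hij])
        have hne : ∀ i j, a i ≠ b j := fun i j hij => by
          have h1 : (b 0).1 + (b 0).2 ≤ (b j).1 + (b j).2 := hb (Fin.zero_le j)
          have := ha i
          rw [hij] at this
          push_cast at hd
          omega
        rw [disjointPathsGF_eq_sum w ha hinj fun i => hne i i, det_pathGF_eq_sum w hne]
        refine sum_congr rfl fun ε _ => congrArg _ ?_
        by_cases hε : Function.Injective fun i => stepTo (ε i) (a i)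
        · refine ihd _ (s + 1) (fun i => by rw [stepTo_sum, ha]) (fun i j hij => ?_)
            (by push_cast at hd; linarith)
          refine lt_of_le_of_ne ?_ fun heq => hij.ne (hε ?_)
          -- one step cannot reverse the order of two points
          · have := hmono hij
            simp only [stepTo_fst] at this ⊢
            split_ifs <;> omega
          · have h1 := stepTo_sum (ε i) (a i)
            have h2 := stepTo_sum (ε j) (a j)
            have := ha i
            have := ha j
            simp only at heq
            exact Prod.ext heq (by simp only; omega)
        · rw [disjointPathsGF_not_injective w hε]
          obtain ⟨i, j, hij, hne⟩ := Function.not_injective_iff.1 hε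
          refine (Matrix.det_zero_of_row_eq hne ?_).symm
          funext l
          simp only [Matrix.of_apply]
          rw [hij]
    rcases le_or_gt s ((b 0).1 + (b 0).2) with h | h
    · exact main ((b 0).1 + (b 0).2 - s).toNat a s ha hmono (by omega)
    · have hlt : ∀ i : Fin (n + 1), ¬ a i ≤ b 0 := fun i hle => by
        have := hle.1
        have := hle.2
        have := ha i
        omega
      rw [disjointPathsGF_eq_zero w 0 (hlt 0)]
      symm
      exact Matrix.det_eq_zero_of_column_eq_zero 0 fun i => pathGF_eq_zero w (hlt i)

end LGV

/-! ### The coefficients of a power sum -/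

section Coefficients

variable {R : Type*} [CommRing R]

/-- The coefficients `c k j` in `A ^ k + B ^ k = ∑ j, c k j * S ^ (k - j) * t ^ j`, where
`A + B = (1 + q) * S` and `A * B = S * (q * S - t)`. -/
def powSumCoeff (q : R) : ℕ → ℕ → R
  | 0, 0 => 2
  | 0, _ + 1 => 0
  | 1, 0 => 1 + q
  | 1, _ + 1 => 0
  | k + 2, 0 => (1 + q) * powSumCoeff q (k + 1) 0 - q * powSumCoeff q k 0
  | k + 2, j + 1 =>
    (1 + q) * powSumCoeff q (k + 1) (j + 1) - q * powSumCoeff q k (j + 1) + powSumCoeff q k j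

theorem powSumCoeff_eq_zero (q : R) : ∀ k j : ℕ, k < 2 * j → powSumCoeff q k j = 0
  | 0, 0, h => by omega
  | 0, _ + 1, _ => by simp [powSumCoeff]
  | 1, 0, h => by omega
  | 1, _ + 1, _ => by simp [powSumCoeff]
  | k + 2, 0, h => by omega
  | k + 2, j + 1, h => by
    rw [powSumCoeff, powSumCoeff_eq_zero q (k + 1) (j + 1) (by omega),
      powSumCoeff_eq_zero q k (j + 1) (by omega), powSumCoeff_eq_zero q k j (by omega)]
    ring

theorem powSumCoeff_zero_right (q : R) : ∀ k : ℕ, powSumCoeff q k 0 = 1 + q ^ k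
  | 0 => by simp [powSumCoeff]; norm_num
  | 1 => by simp [powSumCoeff]
  | k + 2 => by
    rw [powSumCoeff, powSumCoeff_zero_right q (k + 1), powSumCoeff_zero_right q k]
    ring

theorem map_powSumCoeff {R' : Type*} [CommRing R'] (f : R →+* R') (q : R) :
    ∀ k j : ℕ, f (powSumCoeff q k j) = powSumCoeff (f q) k j
  | 0, 0 => by simp only [powSumCoeff, map_ofNat]
  | 0, _ + 1 => by simp [powSumCoeff]
  | 1, 0 => by simp [powSumCoeff]
  | 1, _ + 1 => by simp [powSumCoeff]
  | k + 2, 0 => by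
    simp only [powSumCoeff, map_sub, map_mul, map_add, map_one,
      map_powSumCoeff f q (k + 1) 0, map_powSumCoeff f q k 0]
  | k + 2, j + 1 => by
    simp only [powSumCoeff, map_sub, map_mul, map_add, map_one,
      map_powSumCoeff f q (k + 1) (j + 1), map_powSumCoeff f q k (j + 1), map_powSumCoeff f q k j]

/-- `∏ (1 - c z)` over the weights `c = 1, q` of two consecutive columns. -/
noncomputable def pairSeries (q : R) : PowerSeries R :=
  (1 - PowerSeries.X) * (1 - PowerSeries.C q * PowerSeries.X)

theorem isUnit_pairSeries (q : R) : IsUnit (pairSeries q) := by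
  rw [PowerSeries.isUnit_iff_constantCoeff]
  simp [pairSeries]

theorem coeff_zero_pairSeries_mul (q : R) (f : PowerSeries R) :
    PowerSeries.coeff 0 (pairSeries q * f) = PowerSeries.coeff 0 f := by
  simp [pairSeries]

theorem pairSeries_mul (q : R) (f : PowerSeries R) : pairSeries q * f =
    f - (PowerSeries.C (1 + q) * (PowerSeries.X * f) -
      PowerSeries.C q * (PowerSeries.X * (PowerSeries.X * f))) := by
  simp only [pairSeries, map_add, map_one]
  ring

theorem coeff_one_pairSeries_mul (q : R) (f : PowerSeries R) :
    PowerSeries.coeff 1 (pairSeries q * f) =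
      PowerSeries.coeff 1 f - (1 + q) * PowerSeries.coeff 0 f := by
  rw [pairSeries_mul]
  simp only [map_sub, PowerSeries.coeff_C_mul]
  rw [show (1 : ℕ) = 0 + 1 from rfl, PowerSeries.coeff_succ_X_mul, PowerSeries.coeff_succ_X_mul,
    PowerSeries.coeff_zero_X_mul]
  ring

theorem coeff_add_two_pairSeries_mul (q : R) (f : PowerSeries R) (N : ℕ) :
    PowerSeries.coeff (N + 2) (pairSeries q * f) = PowerSeries.coeff (N + 2) f -
      (1 + q) * PowerSeries.coeff (N + 1) f + q * PowerSeries.coeff N f := by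
  rw [pairSeries_mul]
  simp only [map_sub, PowerSeries.coeff_C_mul]
  rw [show N + 2 = N + 1 + 1 from rfl, PowerSeries.coeff_succ_X_mul, PowerSeries.coeff_succ_X_mul,
    PowerSeries.coeff_succ_X_mul]
  ring

/-- The generating function of the coefficients `powSumCoeff q k j` for fixed `j`. -/
theorem pairSeries_pow_mul_mk (q : R) (j : ℕ) :
    pairSeries q ^ (j + 1) * PowerSeries.mk (fun N => powSumCoeff q (N + 2 * j) j) =
      (1 - PowerSeries.X) + (1 - PowerSeries.C q * PowerSeries.X) := by
  induction j with
  | zero =>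
    rw [zero_add, pow_one]
    ext N
    match N with
    | 0 =>
      rw [coeff_zero_pairSeries_mul]
      simp [powSumCoeff]
      norm_num
    | 1 =>
      rw [coeff_one_pairSeries_mul]
      simp [powSumCoeff, PowerSeries.coeff_one]
      ring
    | N + 2 =>
      rw [coeff_add_two_pairSeries_mul]
      simp [powSumCoeff, PowerSeries.coeff_one, PowerSeries.coeff_X]
  | succ j ih =>
    rw [← ih, pow_succ _ (j + 1), mul_assoc]
    congr 1
    ext N
    match N with
    | 0 =>
      rw [coeff_zero_pairSeries_mul]
      simp only [PowerSeries.coeff_mk, zero_add]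
      rw [show 2 * (j + 1) = 2 * j + 2 by ring, powSumCoeff,
        powSumCoeff_eq_zero q _ (j + 1) (by omega), powSumCoeff_eq_zero q _ (j + 1) (by omega)]
      ring
    | 1 =>
      rw [coeff_one_pairSeries_mul]
      simp only [PowerSeries.coeff_mk, zero_add]
      rw [show 1 + 2 * (j + 1) = (1 + 2 * j) + 2 by ring, powSumCoeff,
        powSumCoeff_eq_zero q (1 + 2 * j) (j + 1) (by omega)]
      ring_nf
    | N + 2 =>
      rw [coeff_add_two_pairSeries_mul]
      simp only [PowerSeries.coeff_mk]
      rw [show N + 2 + 2 * (j + 1) = (N + 2 + 2 * j) + 2 by ring, powSumCoeff]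
      ring_nf

/-- The lower triangular matrix with the entry `c(K, K - l) + α * c(K - 1, K - l)` in row `K` and
column `l`, where `c = powSumCoeff q`; `α = 0` belongs to the exponents `r = 2 m` and
`α = p`, `q = p ^ 2` to `r = 2 m - 1`. It is used for `1 ≤ K` only. -/
def salieMatrix (q α : R) (K l : ℕ) : R :=
  if l ≤ K then powSumCoeff q K (K - l) + α * powSumCoeff q (K - 1) (K - l) else 0

theorem map_salieMatrix {R' : Type*} [CommRing R'] (f : R →+* R') (q α : R) (K l : ℕ) :
    f (salieMatrix q α K l) = salieMatrix (f q) (f α) K l := by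
  simp only [salieMatrix, apply_ite f, map_add, map_mul, map_powSumCoeff, map_zero]

end Coefficients

/-! ### Path generating functions for the step weights -/

section StepWeights

variable {R : Type*} [CommRing R]

theorem LatticePath.weight_congr {w w' : ℤ × ℤ → ℤ × ℤ → R} {a b : ℤ × ℤ}
    (h : ∀ s t, a ≤ s → w s t = w' s t) (L : LatticePath a b) : L.weight w = L.weight w' := by
  unfold LatticePath.weight
  congr 1
  refine List.map_congr_left fun e he => h _ _ (L.start_le ?_)
  exact (List.of_mem_zip he).1

theorem pathGF_congr {w w' : ℤ × ℤ → ℤ × ℤ → R} {a b : ℤ × ℤ}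
    (h : ∀ s t, a ≤ s → w s t = w' s t) : pathGF w a b = pathGF w' a b :=
  sum_congr rfl fun L _ => L.weight_congr h

theorem pathGF_eq_add (w : ℤ × ℤ → ℤ × ℤ → R) {a b : ℤ × ℤ} (h : a ≠ b) :
    pathGF w a b = w a (a + (1, 0)) * pathGF w (a + (1, 0)) b +
      w a (a + (0, 1)) * pathGF w (a + (0, 1)) b := by
  rw [pathGF_eq_sum w h, Fintype.sum_bool]
  rfl

/-- The generating function of the paths with end point `(x', y)` that start in the column `x`,
by the number of vertical steps. -/
noncomputable def columnSeries (w : ℤ × ℤ → ℤ × ℤ → R) (x' y x : ℤ) : PowerSeries R :=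
  PowerSeries.mk fun N => pathGF w (x, y - N) (x', y)

variable {w : ℤ × ℤ → ℤ × ℤ → R} {c : ℤ → R}

/-- Removing the first column divides the series by `1 / (1 - c x * z)`. -/
theorem columnSeries_of_lt (h0 : ∀ s, w s (s + (1, 0)) = 1) (h1 : ∀ s, w s (s + (0, 1)) = c s.1)
    {x' y x : ℤ} (h : x < x') :
    (1 - PowerSeries.C (c x) * PowerSeries.X) * columnSeries w x' y x =
      columnSeries w x' y (x + 1) := by
  ext N
  rw [sub_mul, one_mul, mul_assoc, map_sub, PowerSeries.coeff_C_mul]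
  have hne : ∀ y₁ : ℤ, ((x, y₁) : ℤ × ℤ) ≠ (x', y) := fun y₁ hh => h.ne (congrArg Prod.fst hh)
  cases N with
  | zero =>
    rw [PowerSeries.coeff_zero_X_mul]
    simp only [columnSeries, PowerSeries.coeff_mk]
    rw [pathGF_eq_add w (hne _), h0, pathGF_eq_zero w (a := _ + (0, 1))]
    · simp
    · simp [Prod.le_def]
  | succ N =>
    rw [PowerSeries.coeff_succ_X_mul]
    simp only [columnSeries, PowerSeries.coeff_mk]
    rw [pathGF_eq_add w (hne _), h0, h1]
    have : ((x, y - ((N + 1 : ℕ) : ℤ)) : ℤ × ℤ) + (0, 1) = (x, y - N) := by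
      ext <;> simp; ring
    rw [this]
    simp

theorem columnSeries_self (h1 : ∀ s, w s (s + (0, 1)) = c s.1) (x' y : ℤ) :
    (1 - PowerSeries.C (c x') * PowerSeries.X) * columnSeries w x' y x' = 1 := by
  ext N
  rw [sub_mul, one_mul, mul_assoc, map_sub, PowerSeries.coeff_C_mul]
  cases N with
  | zero =>
    rw [PowerSeries.coeff_zero_X_mul]
    simp [columnSeries, pathGF_self]
  | succ N =>
    rw [PowerSeries.coeff_succ_X_mul]
    simp only [columnSeries, PowerSeries.coeff_mk]
    rw [pathGF_eq_add w, h1, pathGF_eq_zero w (a := _ + (1, 0))]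
    · have : ((x', y - ((N + 1 : ℕ) : ℤ)) : ℤ × ℤ) + (0, 1) = (x', y - N) := by
        ext <;> simp; ring
      rw [this]
      simp [PowerSeries.coeff_one]
    · simp [Prod.le_def]
    · simp; omega

open Classical in
/-- The weight of vertical steps in the column `x`. -/
noncomputable def columnWeight (q : R) (I : Finset ℤ) (x : ℤ) : R :=
  if (∃ i ∈ I, x = 2 * i - 1) ∨ ∃ i : ℤ, i ∉ I ∧ x = 2 * i then q else 1

theorem stepWeight_right (q : R) (I : Finset ℤ) (s : ℤ × ℤ) :
    stepWeight q I s (s + (1, 0)) = 1 := by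
  simp [stepWeight, IsVertical]

open Classical in
theorem stepWeight_up (q : R) (I : Finset ℤ) (s : ℤ × ℤ) :
    stepWeight q I s (s + (0, 1)) = columnWeight q I s.1 := by
  unfold stepWeight columnWeight
  exact if_congr (by simp [IsVertical]) rfl rfl

open Classical in
theorem columnWeight_even (q : R) (I : Finset ℤ) (a : ℤ) :
    columnWeight q I (2 * a) = if a ∈ I then 1 else q := by
  have h1 : ¬ ∃ i ∈ I, 2 * a = 2 * i - 1 := by rintro ⟨i, -, h⟩; omega
  have h2 : (∃ i : ℤ, i ∉ I ∧ 2 * a = 2 * i) ↔ a ∉ I :=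
    ⟨fun ⟨i, hi, h⟩ => by rwa [show a = i by omega], fun h => ⟨a, h, rfl⟩⟩
  simp only [columnWeight, h1, h2, false_or]
  split_ifs <;> simp_all

open Classical in
theorem columnWeight_odd (q : R) (I : Finset ℤ) (a : ℤ) :
    columnWeight q I (2 * a + 1) = if a + 1 ∈ I then q else 1 := by
  have h1 : ¬ ∃ i : ℤ, i ∉ I ∧ 2 * a + 1 = 2 * i := by rintro ⟨i, -, h⟩; omega
  have h2 : (∃ i ∈ I, 2 * a + 1 = 2 * i - 1) ↔ a + 1 ∈ I :=
    ⟨fun ⟨i, hi, h⟩ => by rwa [show a + 1 = i by omega], fun h => ⟨a + 1, h, by ring⟩⟩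
  simp only [columnWeight, h1, h2, or_false]

/-- The columns `2i - 1` and `2i` always have the weights `1` and `q` in some order; only the
weight of the first column of a path depends on `I`. -/
theorem columnSeries_stepWeight (q : R) (I : Finset ℤ) (y : ℤ) (j : ℕ) : ∀ a : ℤ,
    (1 - PowerSeries.C (columnWeight q I (2 * a)) * PowerSeries.X) * (pairSeries q ^ j *
      columnSeries (stepWeight q I) (2 * (a + j)) y (2 * a)) = 1 := by
  classical
  induction j with
  | zero =>
    intro a
    have := columnSeries_self (w := stepWeight q I) (stepWeight_up q I) (2 * a) y
    simpa using this
  | succ j ih =>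
    intro a
    have h1 := columnSeries_of_lt (stepWeight_right q I) (stepWeight_up q I) (y := y)
      (x := 2 * a) (x' := 2 * (a + (j + 1 : ℕ))) (by push_cast; omega)
    have h2 := columnSeries_of_lt (stepWeight_right q I) (stepWeight_up q I) (y := y)
      (x := 2 * a + 1) (x' := 2 * (a + (j + 1 : ℕ))) (by push_cast; omega)
    have h3 := ih (a + 1)
    have e1 : 2 * (a + 1 + (j : ℤ)) = 2 * (a + (j + 1 : ℕ)) := by push_cast; ring
    have e2 : 2 * a + 1 + 1 = 2 * (a + 1) := by ring
    rw [e2] at h2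
    rw [e1, ← h2, ← h1] at h3
    have h4 : pairSeries q = (1 - PowerSeries.C (columnWeight q I (2 * a + 1)) * PowerSeries.X) *
        (1 - PowerSeries.C (columnWeight q I (2 * (a + 1))) * PowerSeries.X) := by
      rw [columnWeight_even, columnWeight_odd, pairSeries]
      split_ifs
      · simp [mul_comm]
      · simp
    linear_combination h3 + (1 - PowerSeries.C (columnWeight q I (2 * a)) * PowerSeries.X) *
      pairSeries q ^ j * columnSeries (stepWeight q I) (2 * (a + (j + 1 : ℕ))) y (2 * a) * h4

theorem isUnit_one_sub_C_mul_X (x : R) :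
    IsUnit (1 - PowerSeries.C x * PowerSeries.X : PowerSeries R) := by
  rw [PowerSeries.isUnit_iff_constantCoeff]
  simp

theorem columnSeries_stepWeight_congr (q : R) {I J : Finset ℤ} {a : ℤ} (h : a ∈ I ↔ a ∈ J) (y : ℤ)
    (j : ℕ) : columnSeries (stepWeight q I) (2 * (a + j)) y (2 * a) =
      columnSeries (stepWeight q J) (2 * (a + j)) y (2 * a) := by
  classical
  have h1 := columnSeries_stepWeight q I y j a
  have h2 := columnSeries_stepWeight q J y j a
  rw [columnWeight_even, if_congr h rfl rfl, ← columnWeight_even] at h1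
  exact ((isUnit_pairSeries q).pow j).mul_left_cancel
    ((isUnit_one_sub_C_mul_X _).mul_left_cancel (h1.trans h2.symm))

/-- The two weightings of the first column together give `1 / (1 - z) + 1 / (1 - q z)` as the factor
of that column. -/
theorem columnSeries_stepWeight_add (q : R) {I J : Finset ℤ} {a : ℤ} (hI : a ∈ I) (hJ : a ∉ J)
    (y : ℤ) (j : ℕ) : columnSeries (stepWeight q I) (2 * (a + j)) y (2 * a) +
      columnSeries (stepWeight q J) (2 * (a + j)) y (2 * a) =
        PowerSeries.mk fun N => powSumCoeff q (N + 2 * j) j := by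
  classical
  have h1 := columnSeries_stepWeight q I y j a
  have h2 := columnSeries_stepWeight q J y j a
  rw [columnWeight_even, if_pos hI, map_one, one_mul] at h1
  rw [columnWeight_even, if_neg hJ] at h2
  refine ((isUnit_pairSeries q).pow (j + 1)).mul_left_cancel ?_
  rw [pairSeries_pow_mul_mk]
  have hD : pairSeries q = (1 - PowerSeries.X) * (1 - PowerSeries.C q * PowerSeries.X) := rfl
  linear_combination (1 - PowerSeries.C q * PowerSeries.X) * h1 + (1 - PowerSeries.X) * h2 +
    pairSeries q ^ j * (columnSeries (stepWeight q I) (2 * (a + j)) y (2 * a) +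
      columnSeries (stepWeight q J) (2 * (a + j)) y (2 * a)) * hD

end StepWeights

/-! ### The path count as a determinant -/

section Determinant

variable {R : Type*} [CommRing R]

theorem pathGF_eq_coeff_columnSeries (w : ℤ × ℤ → ℤ × ℤ → R) {x x' y y' : ℤ} (h : y ≤ y') :
    pathGF w (x, y) (x', y') = PowerSeries.coeff (y' - y).toNat (columnSeries w x' y' x) := by
  rw [columnSeries, PowerSeries.coeff_mk, Int.toNat_of_nonneg (by omega), sub_sub_cancel]

theorem pathGF_stepWeight_congr (q : R) {I J : Finset ℤ} {a : ℤ} (h : a ∈ I ↔ a ∈ J)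
    (b y y' : ℤ) : pathGF (stepWeight q I) (2 * a, y) (2 * b, y') =
      pathGF (stepWeight q J) (2 * a, y) (2 * b, y') := by
  by_cases hab : a ≤ b ∧ y ≤ y'
  · rw [pathGF_eq_coeff_columnSeries _ hab.2, pathGF_eq_coeff_columnSeries _ hab.2,
      show b = a + (b - a).toNat by omega, columnSeries_stepWeight_congr q h]
  · have : ¬ ((2 * a, y) : ℤ × ℤ) ≤ (2 * b, y') := fun hle => hab
      ⟨by have := hle.1; simp only at this; omega, hle.2⟩
    rw [pathGF_eq_zero _ this, pathGF_eq_zero _ this]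

theorem pathGF_stepWeight_add (q : R) {I J : Finset ℤ} {a : ℤ} (hI : a ∈ I) (hJ : a ∉ J)
    (d K : ℕ) {y y' : ℤ} (hK : (K : ℤ) - 2 * d = y' - y) :
    pathGF (stepWeight q I) (2 * a, y) (2 * (a + d), y') +
      pathGF (stepWeight q J) (2 * a, y) (2 * (a + d), y') = powSumCoeff q K d := by
  by_cases hy : y ≤ y'
  · rw [pathGF_eq_coeff_columnSeries _ hy, pathGF_eq_coeff_columnSeries _ hy, ← map_add,
      columnSeries_stepWeight_add q hI hJ, PowerSeries.coeff_mk]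
    congr
    omega
  · have : ¬ ((2 * a, y) : ℤ × ℤ) ≤ (2 * (a + d), y') := fun hle => hy hle.2
    rw [pathGF_eq_zero _ this, pathGF_eq_zero _ this, powSumCoeff_eq_zero q _ _ (by omega),
      zero_add]

open Classical in
/-- The step weights with `α` added to vertical steps that start in some `u_i`, `i < k`. -/
noncomputable def shiftedWeight (k : ℕ) (q α : R) (I : Finset ℤ) (s t : ℤ × ℤ) : R :=
  stepWeight q I s t + if IsVertical s t ∧ ∃ i < k, s = startPt i then α else 0

/-- A path from `u_j` meets a step with increased weight only at its start, so the increase adds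
the paths that begin with a vertical step of weight `α`. -/
theorem pathGF_shiftedWeight {k j : ℕ} (hj : j < k) (q α : R) (I : Finset ℤ) (b : ℤ × ℤ) :
    pathGF (shiftedWeight k q α I) (startPt j) b = pathGF (stepWeight q I) (startPt j) b +
      α * pathGF (stepWeight q I) (startPt j + (0, 1)) b := by
  have hup : ¬ startPt j + (0, 1) ≤ startPt j := by simp [Prod.le_def]
  have hsum : ∀ i, (startPt i).1 + (startPt i).2 = 0 := fun i => by simp [startPt]
  -- all starting points lie on the antidiagonal `x + y = 0`
  have hc : ∀ e : Bool, pathGF (shiftedWeight k q α I) (stepTo e (startPt j)) b =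
      pathGF (stepWeight q I) (stepTo e (startPt j)) b := fun e => pathGF_congr fun s t hs => by
    rw [shiftedWeight, if_neg, add_zero]
    rintro ⟨-, i, -, rfl⟩
    have := hsum i
    have := hsum j
    have := stepTo_sum e (startPt j)
    have := hs.1
    have := hs.2
    omega
  by_cases h : startPt j = b
  · rw [← h, pathGF_self, pathGF_self, pathGF_eq_zero _ hup, mul_zero, add_zero]
  · rw [pathGF_eq_add _ h, pathGF_eq_add _ h]
    have h1 : shiftedWeight k q α I (startPt j) (startPt j + (1, 0)) = 1 := by
      rw [shiftedWeight, stepWeight_right, if_neg, add_zero]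
      rintro ⟨h, -⟩
      simp [IsVertical] at h
    have h2 : shiftedWeight k q α I (startPt j) (startPt j + (0, 1)) =
        stepWeight q I (startPt j) (startPt j + (0, 1)) + α := by
      rw [shiftedWeight, if_pos ⟨rfl, j, hj, rfl⟩]
    rw [h1, h2, stepWeight_right]
    have ht := hc true
    have hf := hc false
    simp only [stepTo] at ht hf
    simp only [if_true, if_false, Bool.false_eq_true] at ht hf
    rw [ht, hf]
    ring

theorem pathGF_shiftedWeight_congr {k j : ℕ} (hj : j < k) (q α : R) {I J : Finset ℤ}
    (h : (j : ℤ) ∈ I ↔ (j : ℤ) ∈ J) (m i : ℕ) :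
    pathGF (shiftedWeight k q α I) (startPt j) (endPt m k i) =
      pathGF (shiftedWeight k q α J) (startPt j) (endPt m k i) := by
  rw [pathGF_shiftedWeight hj, pathGF_shiftedWeight hj]
  have h1 := pathGF_stepWeight_congr q h (i + 1)
  have e1 : endPt m k i = (2 * ((i : ℤ) + 1), (m : ℤ) - k - 1 - i) := by
    simp [endPt]; ring
  have e2 : startPt j + (0, 1) = (2 * (j : ℤ), -2 * (j : ℤ) + 1) := by simp [startPt]
  rw [e1, e2, startPt, h1, h1]

theorem pathGF_shiftedWeight_add {k j m : ℕ} (hj : j < k) (hk : k < m) (q α : R) {I J : Finset ℤ}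
    (hI : (j : ℤ) ∈ I) (hJ : (j : ℤ) ∉ J) (i : ℕ) :
    pathGF (shiftedWeight k q α I) (startPt j) (endPt m k i) +
      pathGF (shiftedWeight k q α J) (startPt j) (endPt m k i) =
        salieMatrix q α (m - k + i + 1) (m - k + j) := by
  rw [pathGF_shiftedWeight hj, pathGF_shiftedWeight hj, salieMatrix]
  split_ifs with h
  · have e1 : endPt m k i = (2 * ((j : ℤ) + (i + 1 - j : ℕ)), (m : ℤ) - k - 1 - i) := by
      rw [show ((i + 1 - j : ℕ) : ℤ) = i + 1 - j by omega]
      simp [endPt]; ring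
    have e2 : startPt j + (0, 1) = (2 * (j : ℤ), -2 * (j : ℤ) + 1) := by simp [startPt]
    have e3 : m - k + i + 1 - (m - k + j) = i + 1 - j := by omega
    rw [e1, e2, startPt, e3,
      ← pathGF_stepWeight_add q hI hJ (i + 1 - j) (m - k + i + 1)
        (y := -2 * j) (y' := (m : ℤ) - k - 1 - i) (by omega),
      ← pathGF_stepWeight_add q hI hJ (i + 1 - j) (m - k + i + 1 - 1)
        (y := -2 * j + 1) (y' := (m : ℤ) - k - 1 - i) (by omega)]
    ring
  · have h1 : ¬ startPt j ≤ endPt m k i := fun hle => by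
      have := hle.1
      simp only [startPt, endPt] at this
      omega
    have h2 : ¬ startPt j + (0, 1) ≤ endPt m k i := fun hle => by
      have := hle.1
      simp only [startPt, endPt, Prod.fst_add] at this
      omega
    simp only [pathGF_eq_zero _ h1, pathGF_eq_zero _ h2]
    ring

open Classical in
/-- The sum over all subsets `I` splits into a choice for every row of the determinant. -/
theorem sum_det_shiftedWeight {k m : ℕ} (hk : k < m) (q α : R) :
    ∑ I ∈ (Finset.Ico (0 : ℤ) k).powerset, (Matrix.of fun j i : Fin k =>
      pathGF (shiftedWeight k q α I) (startPt j) (endPt m k i)).det =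
    (Matrix.of fun j i : Fin k => salieMatrix q α (m - k + i + 1) (m - k + j)).det := by
  set A : Finset ℤ → Fin k → Fin k → R := fun I j i =>
    pathGF (shiftedWeight k q α I) (startPt j) (endPt m k i) with hA
  set U : Finset ℤ := Finset.Ico (0 : ℤ) k
  have hU : ∀ j : Fin k, ((j : ℕ) : ℤ) ∈ U := fun j => by simp [U]
  have h1 : (Matrix.of fun j i : Fin k => salieMatrix q α (m - k + i + 1) (m - k + j)) =
      A U + A ∅ := by
    funext j i
    exact (pathGF_shiftedWeight_add j.2 hk q α (hU j) (by simp) i).symm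
  rw [h1]
  refine Eq.trans ?_ ((Matrix.detRowAlternating (n := Fin k) (R := R)).toMultilinearMap.map_add_univ
    (A U) (A ∅)).symm
  refine sum_bij' (fun I _ => univ.filter fun j : Fin k => ((j : ℕ) : ℤ) ∈ I)
    (fun s _ => s.image fun j : Fin k => ((j : ℕ) : ℤ)) (fun I _ => mem_univ _) (fun s _ => ?_)
    (fun I hI => ?_) (fun s _ => ?_) (fun I hI => ?_)
  · rw [mem_powerset]
    intro x hx
    obtain ⟨j, -, rfl⟩ := mem_image.1 hx
    exact hU j
  · ext x
    rw [mem_powerset] at hI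
    simp only [mem_image, mem_filter, mem_univ, true_and]
    constructor
    · rintro ⟨j, hj, rfl⟩
      exact hj
    · intro hx
      have := mem_Ico.1 (hI hx)
      refine ⟨⟨x.toNat, by omega⟩, ?_, ?_⟩ <;> simp [Int.toNat_of_nonneg this.1, hx]
  · ext j
    simp only [mem_image, mem_filter, mem_univ, true_and]
    constructor
    · rintro ⟨i, hi, h⟩
      rwa [← Fin.ext (Nat.cast_injective h)]
    · exact fun h => ⟨j, h, rfl⟩
  · change Matrix.det (A I) = Matrix.det _
    congr 1
    funext j i
    by_cases h : ((j : ℕ) : ℤ) ∈ I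
    · rw [Finset.piecewise_eq_of_mem _ _ _ (by simpa using h)]
      exact pathGF_shiftedWeight_congr j.2 q α (by simp [h, hU]) m i
    · rw [Finset.piecewise_eq_of_notMem _ _ _ (by simpa using h)]
      exact pathGF_shiftedWeight_congr j.2 q α (by simp [h]) m i

open Classical in
theorem sum_pathFamily_eq_det {k m : ℕ} (hk : k < m) (q α : R) :
    ∑ L : PathFamily m k with L.NonIntersecting,
      ∑ I ∈ (Finset.Ico (0 : ℤ) k).powerset, L.weight (shiftedWeight k q α I) =
    (Matrix.of fun j i : Fin k => salieMatrix q α (m - k + i + 1) (m - k + j)).det := by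
  rw [← sum_det_shiftedWeight hk, sum_comm]
  refine sum_congr rfl fun I _ => ?_
  rw [← disjointPathsGF_eq_det (shiftedWeight k q α I) (a := fun j : Fin k => startPt j)
    (b := fun i : Fin k => endPt m k i) (s := 0), sum_filter]
  · rfl
  · intro i
    simp [startPt]
  · intro i j hij
    simpa [startPt] using hij
  · intro i j hij
    have : (i : ℕ) ≤ j := hij
    simp only [endPt]
    omega
  · intro i j hij
    have : (i : ℕ) ≤ j := hij
    simp only [endPt]
    omega

end Determinant

/-! ### Inverting a lower triangular matrix -/

section Triangular

variable {K : Type*} [Field K]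

/-- The last row of the inverse of the lower triangular matrix `C` with rows and columns
`1, …, m`. -/
theorem exists_row_of_inverse (C : ℕ → ℕ → K) (m : ℕ) (hC : ∀ l, 1 ≤ l → C l l ≠ 0) :
    ∃ b : ℕ → K, ∀ l, 1 ≤ l → l ≤ m → ∑ k ∈ Icc l m, b k * C k l = if l = m then 1 else 0 := by
  suffices H : ∀ s : ℕ, ∃ b : ℕ → K, ∀ l, 1 ≤ l → l ≤ m → m < l + s →
      ∑ k ∈ Icc l m, b k * C k l = if l = m then 1 else 0 by
    obtain ⟨b, hb⟩ := H m
    exact ⟨b, fun l h1 h2 => hb l h1 h2 (by omega)⟩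
  intro s
  induction s with
  | zero => exact ⟨0, fun l h1 h2 h3 => by omega⟩
  | succ s ih =>
    obtain ⟨b, hb⟩ := ih
    refine ⟨Function.update b (m - s) (((if m - s = m then 1 else 0) -
      ∑ k ∈ Icc (m - s + 1) m, b k * C k (m - s)) / C (m - s) (m - s)), fun l h1 h2 h3 => ?_⟩
    rcases eq_or_ne l (m - s) with rfl | hne
    · rw [← Finset.add_sum_Ioc_eq_sum_Icc h2, Function.update_self, div_mul_cancel₀ _ (hC _ h1)]
      have : ∑ k ∈ Ioc (m - s) m, Function.update b (m - s) (((if m - s = m then 1 else 0) -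
          ∑ k ∈ Icc (m - s + 1) m, b k * C k (m - s)) / C (m - s) (m - s)) k * C k (m - s) =
          ∑ k ∈ Icc (m - s + 1) m, b k * C k (m - s) := by
        refine sum_congr (by ext; simp) fun k hk => ?_
        rw [mem_Icc] at hk
        rw [Function.update_of_ne (by omega)]
      rw [this, sub_add_cancel]
    · rw [← hb l h1 h2 (by omega)]
      refine sum_congr rfl fun k hk => ?_
      rw [mem_Icc] at hk
      rw [Function.update_of_ne (by omega)]

/-- Cramer's rule: the entries of the inverse of a lower triangular matrix are Hessenberg
determinants divided by products of diagonal entries. -/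
theorem row_of_inverse_mul_prod {C : ℕ → ℕ → K} {m : ℕ} {b : ℕ → K}
    (hlow : ∀ k l, k < l → C k l = 0)
    (hb : ∀ l, 1 ≤ l → l ≤ m → ∑ k ∈ Icc l m, b k * C k l = if l = m then 1 else 0)
    {r : ℕ} (hr : r < m) :
    b (m - r) * ∏ i ∈ range (r + 1), C (m - i) (m - i) =
      (-1) ^ r * (Matrix.of fun j i : Fin r => C (m - r + i + 1) (m - r + j)).det := by
  set A : Matrix (Fin (r + 1)) (Fin (r + 1)) K := Matrix.of fun x y => C (m - r + x) (m - r + y)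
    with hA
  set v : Fin (r + 1) → K := fun x => b (m - r + x)
  have hv : Matrix.vecMul v A = Pi.single (Fin.last r) 1 := by
    funext y
    have hy := y.2
    have h := hb (m - r + y) (by omega) (by omega)
    have h1 : ∑ k ∈ Icc (m - r) m, b k * C k (m - r + y) =
        ∑ k ∈ Icc (m - r + y) m, b k * C k (m - r + y) := by
      symm
      refine sum_subset (Icc_subset_Icc_left (by omega)) fun k hk hk' => ?_
      rw [mem_Icc] at hk hk'
      rw [hlow _ _ (by omega), mul_zero]
    have h2 : ∑ k ∈ Icc (m - r) m, b k * C k (m - r + y) =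
        ∑ x ∈ range (r + 1), b (m - r + x) * C (m - r + x) (m - r + y) := by
      rw [← Finset.Ico_add_one_right_eq_Icc, Finset.sum_Ico_eq_sum_range,
        show m + 1 - (m - r) = r + 1 by omega]
    rw [← h1, h2] at h
    change ∑ x : Fin (r + 1), b (m - r + x) * C (m - r + x) (m - r + y) = _
    rw [Fin.sum_univ_eq_sum_range (fun x => b (m - r + x) * C (m - r + x) (m - r + y)), h,
      Pi.single_apply]
    refine if_congr ?_ rfl rfl
    rw [Fin.ext_iff, Fin.val_last]
    omega
  have h1 : A.det * v 0 = A.adjugate (Fin.last r) 0 := by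
    have := congrArg (fun u => Matrix.vecMul u A.adjugate 0) hv
    simp only [Matrix.vecMul_vecMul, Matrix.mul_adjugate, Matrix.vecMul_smul, Matrix.vecMul_one,
      Matrix.single_one_vecMul, Pi.smul_apply, smul_eq_mul] at this
    exact this
  have h2 : A.det = ∏ i ∈ range (r + 1), C (m - i) (m - i) := by
    rw [Matrix.det_of_isLowerTriangular A fun x y hxy => ?_]
    · rw [← Finset.prod_range_reflect,
        ← Fin.prod_univ_eq_prod_range (fun i => C (m - (r + 1 - 1 - i)) (m - (r + 1 - 1 - i)))]
      refine Fintype.prod_congr _ _ fun x => ?_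
      have := x.2
      rw [hA, Matrix.of_apply, show m - (r + 1 - 1 - (x : ℕ)) = m - r + x by omega]
    · have : (x : ℕ) < y := by simpa using hxy
      exact hlow _ _ (by omega)
  have h3 : A.adjugate (Fin.last r) 0 =
      (-1) ^ r * (Matrix.of fun j i : Fin r => C (m - r + i + 1) (m - r + j)).det := by
    rw [Matrix.adjugate_fin_succ_eq_det_submatrix, ← Matrix.det_transpose]
    simp only [Fin.val_last, Fin.val_zero, zero_add]
    congr 2
    ext x y
    simp [hA, add_assoc]
  rw [← h2, ← h3, ← h1, mul_comm]
  rfl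

end Triangular

/-! ### The alternating power sums -/

section PowerSums

variable {K : Type*} [Field K]

/-- The expansion that defines `powSumCoeff`, dehomogenized: `a = A / S`, `b = B / S`,
`τ = t / S`. -/
theorem pow_add_pow_eq_sum {q a b τ : K} (h1 : a + b = 1 + q) (h2 : a * b = q - τ) :
    ∀ k M : ℕ, k < 2 * M → a ^ k + b ^ k = ∑ j ∈ range M, powSumCoeff q k j * τ ^ j
  | 0, 0, h => by omega
  | 0, M + 1, _ => by
    rw [sum_range_succ']
    simp [powSumCoeff]
    norm_num
  | 1, 0, h => by omega
  | 1, M + 1, _ => by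
    rw [sum_range_succ']
    simp [powSumCoeff, h1]
  | k + 2, 0, h => by omega
  | k + 2, M + 1, h => by
    have e1 := pow_add_pow_eq_sum h1 h2 (k + 1) (M + 1) (by omega)
    have e2 := pow_add_pow_eq_sum h1 h2 k (M + 1) (by omega)
    have e3 := pow_add_pow_eq_sum h1 h2 k M (by omega)
    rw [sum_range_succ'] at e1 e2 ⊢
    have e4 : ∑ j ∈ range M, powSumCoeff q (k + 2) (j + 1) * τ ^ (j + 1) =
        (1 + q) * ∑ j ∈ range M, powSumCoeff q (k + 1) (j + 1) * τ ^ (j + 1) -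
          q * ∑ j ∈ range M, powSumCoeff q k (j + 1) * τ ^ (j + 1) +
          τ * ∑ j ∈ range M, powSumCoeff q k j * τ ^ j := by
      simp only [mul_sum, ← sum_sub_distrib, ← sum_add_distrib]
      refine sum_congr rfl fun j _ => ?_
      rw [powSumCoeff]
      ring
    rw [e4, powSumCoeff]
    linear_combination (1 + q) * e1 - q * e2 + τ * e3 + (a ^ (k + 1) + b ^ (k + 1)) * h1 -
      (a ^ k + b ^ k) * h2

/-- The linear combination with coefficients `β` of the expressions
`τ ^ (m - k) * (a ^ k + α a ^ (k - 1) + b ^ k + α b ^ (k - 1))` collapses, because `β` is the last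
row of the inverse of `salieMatrix`. -/
theorem sum_row_of_inverse {q α a b τ : K} (h1 : a + b = 1 + q) (h2 : a * b = q - τ) {m : ℕ}
    (hm : 1 ≤ m) {β : ℕ → K} (hβ : ∀ l, 1 ≤ l → l ≤ m →
      ∑ k ∈ Icc l m, β k * salieMatrix q α k l = if l = m then 1 else 0) :
    ∑ k ∈ Icc 1 m, β k * τ ^ (m - k) *
      (a ^ k + α * a ^ (k - 1) + (b ^ k + α * b ^ (k - 1))) = 1 := by
  have e1 : ∀ k ∈ Icc 1 m, β k * τ ^ (m - k) *
      (a ^ k + α * a ^ (k - 1) + (b ^ k + α * b ^ (k - 1))) =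
      ∑ l ∈ Icc 1 k, β k * salieMatrix q α k l * τ ^ (m - l) := fun k hk => by
    rw [mem_Icc] at hk
    have e2 : a ^ k + α * a ^ (k - 1) + (b ^ k + α * b ^ (k - 1)) =
        ∑ j ∈ range k, (powSumCoeff q k j + α * powSumCoeff q (k - 1) j) * τ ^ j := by
      have f1 := pow_add_pow_eq_sum h1 h2 k k (by omega)
      have f2 := pow_add_pow_eq_sum h1 h2 (k - 1) k (by omega)
      simp only [add_mul, sum_add_distrib, mul_assoc, ← mul_sum, ← f1, ← f2]
      ring
    rw [e2, mul_sum, ← sum_range_reflect, range_eq_Ico,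
      ← sum_Ico_add_right_sub_eq (c := 1) (a := 0) (b := k), zero_add,
      Finset.Ico_add_one_right_eq_Icc]
    refine sum_congr rfl fun l hl => ?_
    rw [mem_Icc] at hl
    rw [salieMatrix, if_pos hl.2, show k - 1 - (l - 1) = k - l by omega,
      show m - l = (m - k) + (k - l) by omega, pow_add]
    ring
  rw [sum_congr rfl e1, sum_comm' (t' := Icc 1 m) (s' := fun l => Icc l m)
    (by intro k l; simp only [mem_Icc]; omega)]
  simp only [← sum_mul]
  rw [sum_eq_single_of_mem m (by simpa using hm)]
  · rw [hβ m hm le_rfl]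
    simp
  · intro l hl hlm
    rw [mem_Icc] at hl
    rw [hβ l hl.1 hl.2, if_neg hlm, zero_mul]

theorem altPowerSum_zero (p : K) (r : ℕ) : altPowerSum p r 0 = 0 := by simp [altPowerSum]

theorem altPowerSum_succ (p : K) (r n : ℕ) :
    altPowerSum p r (n + 1) = qInt (p ^ 2) (n + 1) ^ r - p ^ r * altPowerSum p r n := by
  rw [altPowerSum, sum_Icc_succ_top (by omega), altPowerSum, mul_sum, add_comm, sub_eq_add_neg,
    ← sum_neg_distrib]
  congr 1
  · simp
  · refine sum_congr rfl fun k hk => ?_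
    rw [mem_Icc] at hk
    rw [show n + 1 - k = (n - k) + 1 by omega, mul_add, pow_succ, pow_add]
    ring

theorem qInt_zero (q : K) : qInt q 0 = 0 := by simp [qInt]

theorem qInt_add {q : K} (hq : 1 - q ≠ 0) (n : ℕ) :
    qInt q (n + 2) + q * qInt q n = (1 + q) * qInt q (n + 1) := by
  simp only [qInt]
  field_simp
  ring

theorem qInt_mul {q : K} (hq : 1 - q ≠ 0) (n : ℕ) :
    qInt q (n + 2) * (q * qInt q n) = q * qInt q (n + 1) ^ 2 - q ^ (n + 1) := by
  simp only [qInt]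
  field_simp
  ring

variable {p : K}

theorem one_sub_pow_ne_zero (hp : ∀ k, 1 ≤ k → p ^ k ≠ 1) {k : ℕ} (hk : 1 ≤ k) : 1 - p ^ k ≠ 0 :=
  sub_ne_zero.2 (hp k hk).symm

theorem qInt_sq_ne_zero (hp : ∀ k, 1 ≤ k → p ^ k ≠ 1) {n : ℕ} (hn : 1 ≤ n) :
    qInt (p ^ 2) n ≠ 0 := by
  rw [qInt, ← pow_mul]
  exact div_ne_zero (one_sub_pow_ne_zero hp (by omega)) (one_sub_pow_ne_zero hp (by omega))

/-- Both sides `T` satisfy `T n + q ^ m * T (n - 1) = [n] ^ (2 m)` and vanish for `n = 0`. -/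
theorem altPowerSum_even (hp : ∀ k, 1 ≤ k → p ^ k ≠ 1) {m : ℕ} (hm : 1 ≤ m) {β : ℕ → K}
    (hβ : ∀ l, 1 ≤ l → l ≤ m →
      ∑ k ∈ Icc l m, β k * salieMatrix (p ^ 2) 0 k l = if l = m then 1 else 0) (n : ℕ) :
    altPowerSum p (2 * m) n = ∑ k ∈ Icc 1 m, β k * ((p ^ 2) ^ n) ^ (m - k) *
      (qInt (p ^ 2) n * qInt (p ^ 2) (n + 1)) ^ k := by
  set q := p ^ 2 with hq
  have hq1 : 1 - q ≠ 0 := one_sub_pow_ne_zero hp (by omega)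
  induction n with
  | zero =>
    rw [altPowerSum_zero]
    symm
    refine sum_eq_zero fun k hk => ?_
    rw [mem_Icc] at hk
    rw [qInt_zero, zero_mul, zero_pow (by omega), mul_zero]
  | succ n ih =>
    rw [altPowerSum_succ, ih, ← hq, sub_eq_iff_eq_add, mul_sum, ← sum_add_distrib]
    have hs : qInt q (n + 1) ≠ 0 := qInt_sq_ne_zero hp (by omega)
    set s := qInt q (n + 1)
    have h1 : qInt q (n + 2) / s + q * qInt q n / s = 1 + q := by
      rw [← add_div, qInt_add hq1, mul_div_cancel_right₀ _ hs]
    have h2 : qInt q (n + 2) / s * (q * qInt q n / s) = q - q ^ (n + 1) / s ^ 2 := by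
      rw [div_mul_div_comm,
        show qInt q (n + 2) * (q * qInt q n) = q * s ^ 2 - q ^ (n + 1) from qInt_mul hq1 n]
      field_simp
    have key := sum_row_of_inverse h1 h2 hm hβ
    rw [← mul_one (s ^ (2 * m)), ← key, mul_sum]
    refine sum_congr rfl fun k hk => ?_
    rw [mem_Icc] at hk
    obtain ⟨d, rfl⟩ := Nat.exists_eq_add_of_le hk.2
    have hp2 : p ^ (2 * (k + d)) = q ^ k * q ^ d := by rw [hq]; ring
    rw [hp2, Nat.add_sub_cancel_left]
    simp only [div_pow, mul_pow, zero_mul, add_zero]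
    field_simp
    ring

/-- Both sides `T` satisfy `T n + p ^ (2 m - 1) * T (n - 1) = [n] ^ (2 m - 1)`; the first summand
on the right solves the homogeneous recursion and makes the right side vanish for `n = 0`. -/
theorem altPowerSum_odd (hp : ∀ k, 1 ≤ k → p ^ k ≠ 1) {m : ℕ} (hm : 1 ≤ m) {β : ℕ → K}
    (hβ : ∀ l, 1 ≤ l → l ≤ m →
      ∑ k ∈ Icc l m, β k * salieMatrix (p ^ 2) p k l = if l = m then 1 else 0) (n : ℕ) :
    altPowerSum p (2 * m - 1) n = -(-1) ^ n * β 1 * p ^ ((2 * m - 1) * n) +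
      (1 - p ^ (2 * n + 1)) / (1 - p) * ∑ k ∈ Icc 1 m, β k * ((p ^ 2) ^ n) ^ (m - k) *
        (qInt (p ^ 2) n * qInt (p ^ 2) (n + 1)) ^ (k - 1) := by
  set q := p ^ 2 with hq
  have hq1 : 1 - q ≠ 0 := one_sub_pow_ne_zero hp (by omega)
  have hp1 : 1 - p ≠ 0 := by simpa using one_sub_pow_ne_zero hp le_rfl
  induction n with
  | zero =>
    rw [altPowerSum_zero, sum_eq_single_of_mem 1 (by simpa using hm)]
    · simp [hp1]
    · intro k hk hk1
      rw [mem_Icc] at hk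
      rw [qInt_zero, zero_mul, zero_pow (by omega), mul_zero]
  | succ n ih =>
    have hs : qInt q (n + 1) ≠ 0 := qInt_sq_ne_zero hp (by omega)
    have f1 : (1 - p ^ (2 * (n + 1) + 1)) / (1 - p) = p * qInt q (n + 1) + qInt q (n + 2) := by
      simp only [qInt]
      field_simp
      rw [hq]
      ring
    have f2 : p * ((1 - p ^ (2 * n + 1)) / (1 - p)) = p * qInt q (n + 1) + q * qInt q n := by
      simp only [qInt]
      field_simp
      rw [hq]
      ring
    rw [altPowerSum_succ, ih, ← hq]
    set s := qInt q (n + 1)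
    have h1 : qInt q (n + 2) / s + q * qInt q n / s = 1 + q := by
      rw [← add_div, qInt_add hq1, mul_div_cancel_right₀ _ hs]
    have h2 : qInt q (n + 2) / s * (q * qInt q n / s) = q - q ^ (n + 1) / s ^ 2 := by
      rw [div_mul_div_comm,
        show qInt q (n + 2) * (q * qInt q n) = q * s ^ 2 - q ^ (n + 1) from qInt_mul hq1 n]
      field_simp
    have key := sum_row_of_inverse h1 h2 hm hβ
    have main : s ^ (2 * m - 1) =
        (1 - p ^ (2 * (n + 1) + 1)) / (1 - p) * ∑ k ∈ Icc 1 m, β k * (q ^ (n + 1)) ^ (m - k) *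
          (s * qInt q (n + 1 + 1)) ^ (k - 1) +
        p ^ (2 * m - 1) * ((1 - p ^ (2 * n + 1)) / (1 - p) *
          ∑ k ∈ Icc 1 m, β k * (q ^ n) ^ (m - k) * (qInt q n * s) ^ (k - 1)) := by
      have key' := congrArg (fun x => s ^ (2 * m - 1) * x) key
      simp only [mul_one] at key'
      rw [← key', mul_sum, mul_sum, mul_sum, mul_sum, ← sum_add_distrib]
      refine sum_congr rfl fun k hk => ?_
      rw [mem_Icc] at hk
      obtain ⟨d, rfl⟩ := Nat.exists_eq_add_of_le hk.2
      obtain ⟨k, rfl⟩ := Nat.exists_eq_add_of_le hk.1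
      have e1 : 2 * (1 + k + d) - 1 = 2 * k + 2 * d + 1 := by omega
      have hp2 : p ^ (2 * k + 2 * d + 1) = q ^ k * q ^ d * p := by rw [hq]; ring
      rw [e1, hp2, f1, Nat.add_sub_cancel_left, Nat.add_sub_cancel_left]
      have e2 : q ^ k * q ^ d * p * ((1 - p ^ (2 * n + 1)) / (1 - p) * (β (1 + k) * (q ^ n) ^ d *
          (qInt q n * s) ^ k)) = q ^ k * q ^ d * (p * s + q * qInt q n) *
            (β (1 + k) * (q ^ n) ^ d * (qInt q n * s) ^ k) := by
        rw [← f2]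
        ring
      rw [e2]
      simp only [div_pow, mul_pow, pow_add, pow_one]
      field_simp
      ring
    rw [main, show (2 * m - 1) * (n + 1) = (2 * m - 1) * n + (2 * m - 1) by ring, pow_add p]
    ring

end PowerSums

/-! ### Uniqueness of the coefficients -/

section Uniqueness

variable {K : Type*} [Field K]

/-- The polynomial in `x = q ^ n` whose values are the sums
`∑ k, (-q ^ n) ^ (m - k) * d k * ([n] [n + 1]) ^ (k - 1)`. -/
noncomputable def sumPoly (Y : K[X]) (m : ℕ) (d : ℕ → K) : K[X] :=
  ∑ k ∈ Icc 1 m, (-X) ^ (m - k) * C (d k) * Y ^ (k - 1)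

theorem eq_zero_of_sumPoly_eq_zero {Y : K[X]} (hY : Y.eval 0 ≠ 0) (d : ℕ → K) (m : ℕ)
    (h : sumPoly Y m d = 0) : ∀ k ∈ Icc 1 m, d k = 0 := by
  induction m with
  | zero => simp
  | succ m ih =>
    rw [sumPoly, sum_Icc_succ_top (by omega)] at h
    have h1 : ∑ k ∈ Icc 1 m, (-X) ^ (m + 1 - k) * C (d k) * Y ^ (k - 1) = -X * sumPoly Y m d := by
      rw [sumPoly, mul_sum]
      refine sum_congr rfl fun k hk => ?_
      rw [mem_Icc] at hk
      rw [show m + 1 - k = (m - k) + 1 by omega, pow_succ]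
      ring
    rw [h1] at h
    -- the constant term sees only `d (m + 1)`
    have h2 : d (m + 1) = 0 := by
      have := congrArg (eval 0) h
      simpa [hY] using this
    have h3 : sumPoly Y m d = 0 := by
      rw [h2] at h
      simpa [X_ne_zero] using h
    intro k hk
    rcases eq_or_ne k (m + 1) with rfl | hne
    · exact h2
    · rw [mem_Icc] at hk
      exact ih h3 k (by rw [mem_Icc]; omega)

/-- The product `[n] [n + 1]` as a polynomial in `x = q ^ n`. -/
noncomputable def prodPoly (q : K) : K[X] := C ((1 - q)⁻¹ ^ 2) * ((1 - X) * (1 - C q * X))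

theorem eval_prodPoly (q : K) (n : ℕ) :
    (prodPoly q).eval (q ^ n) = qInt q n * qInt q (n + 1) := by
  simp only [prodPoly, qInt, eval_mul, eval_C, eval_sub, eval_one, eval_X]
  rw [div_eq_mul_inv, div_eq_mul_inv]
  ring

theorem eval_zero_prodPoly {q : K} (hq : 1 - q ≠ 0) : (prodPoly q).eval 0 ≠ 0 := by
  simp [prodPoly, hq]

theorem eval_sumPoly_prodPoly (q : K) (m n : ℕ) (d : ℕ → K) :
    (sumPoly (prodPoly q) m d).eval (q ^ n) = ∑ k ∈ Icc 1 m, (-q ^ n) ^ (m - k) * d k *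
      (qInt q n * qInt q (n + 1)) ^ (k - 1) := by
  simp [sumPoly, eval_finsetSum, eval_prodPoly]

theorem eq_zero_of_forall_eval_pow {q : K} (hq0 : q ≠ 0) (hq : ∀ k, 1 ≤ k → q ^ k ≠ 1)
    {f : K[X]} (h : ∀ n, 1 ≤ n → f.eval (q ^ n) = 0) : f = 0 := by
  refine eq_zero_of_infinite_isRoot f <| Set.infinite_of_injective_forall_mem
    (f := fun n : ℕ => q ^ (n + 1)) (fun a b hab => ?_) fun n => h (n + 1) (by omega)
  by_contra hne
  wlog hlt : a < b generalizing a b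
  · exact this b a hab.symm (Ne.symm hne) (by omega)
  refine hq (b - a) (by omega) (mul_left_cancel₀ (pow_ne_zero (a + 1) hq0) ?_)
  rw [← pow_add, show a + 1 + (b - a) = b + 1 by omega, mul_one]
  exact hab.symm

theorem even_coeff_eq_zero {q : K} (hq0 : q ≠ 0) (hq : ∀ k, 1 ≤ k → q ^ k ≠ 1) {m : ℕ}
    {d : ℕ → K} (h : ∀ n, 1 ≤ n → ∑ k ∈ Icc 1 m, (-q ^ n) ^ (m - k) * d k *
      (qInt q n * qInt q (n + 1)) ^ (k - 1) = 0) : ∀ k ∈ Icc 1 m, d k = 0 := by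
  have hq1 : 1 - q ≠ 0 := by simpa using one_sub_pow_ne_zero hq le_rfl
  refine eq_zero_of_sumPoly_eq_zero (eval_zero_prodPoly hq1) d m ?_
  refine eq_zero_of_forall_eval_pow hq0 hq fun n hn => ?_
  rw [eval_sumPoly_prodPoly, h n hn]

/-- In the odd case the term `(-1) ^ n * e * p ^ ((2 m - 1) n)` is odd in `p ^ n` and the rest is
even, hence both vanish. -/
theorem odd_coeff_eq_zero [CharZero K] {p : K} (hp0 : p ≠ 0) (hp : ∀ k, 1 ≤ k → p ^ k ≠ 1) {m : ℕ}
    (hm : 1 ≤ m) {d : ℕ → K} {e : K} (h : ∀ n, 1 ≤ n → (-1) ^ n * e * p ^ ((2 * m - 1) * n) +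
      (1 - p ^ (2 * n + 1)) / (1 - p) * ∑ k ∈ Icc 1 m, (-(p ^ 2) ^ n) ^ (m - k) * d k *
        (qInt (p ^ 2) n * qInt (p ^ 2) (n + 1)) ^ (k - 1) = 0) : ∀ k ∈ Icc 1 m, d k = 0 := by
  have hp1 : 1 - p ≠ 0 := by simpa using one_sub_pow_ne_zero hp le_rfl
  have hsq : ∀ k, 1 ≤ k → (p ^ 2) ^ k ≠ 1 := fun k hk => by
    rw [← pow_mul]
    exact hp _ (by omega)
  set F := sumPoly (prodPoly (p ^ 2)) m d with hF
  set G : K[X] := C (1 - p)⁻¹ * (1 - C p * X) * F with hG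
  have hGe : ∀ n, G.eval ((p ^ 2) ^ n) = (1 - p ^ (2 * n + 1)) / (1 - p) *
      ∑ k ∈ Icc 1 m, (-(p ^ 2) ^ n) ^ (m - k) * d k *
        (qInt (p ^ 2) n * qInt (p ^ 2) (n + 1)) ^ (k - 1) := fun n => by
    rw [hG, eval_mul, hF, eval_sumPoly_prodPoly]
    simp only [eval_mul, eval_C, eval_sub, eval_one, eval_X]
    congr 1
    field_simp
    ring
  have hW : C e * X ^ (2 * m - 1) + G.comp (X ^ 2) = 0 := by
    refine eq_zero_of_forall_eval_pow (pow_ne_zero 2 hp0) hsq fun n hn => ?_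
    have := h (2 * n) (by omega)
    rw [← hGe, (even_two_mul n).neg_one_pow, one_mul] at this
    simp only [eval_add, eval_mul, eval_C, eval_pow, eval_X, eval_comp]
    rw [← this]
    congr 2 <;> ring
  have hodd : Odd (2 * m - 1) := ⟨m - 1, by omega⟩
  have hG0 : G = 0 := by
    refine eq_zero_of_forall_eval_pow (pow_ne_zero 2 hp0) hsq fun n hn => ?_
    have h1 := congrArg (eval (p ^ n)) hW
    have h2 := congrArg (eval (-p ^ n)) hW
    simp only [eval_add, eval_mul, eval_C, eval_pow, eval_X, eval_comp, eval_zero, hodd.neg_pow,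
      even_two.neg_pow] at h1 h2
    have h3 : (2 : K) * G.eval ((p ^ n) ^ 2) = 0 := by linear_combination h1 + h2
    rw [← pow_mul, mul_comm 2 n, pow_mul]
    simpa using h3
  refine eq_zero_of_sumPoly_eq_zero (eval_zero_prodPoly (q := p ^ 2)
    (one_sub_pow_ne_zero hp (by omega))) d m ?_
  rcases mul_eq_zero.1 hG0 with h0 | h0
  · have := congrArg (eval 0) h0
    simp [hp1] at this
  · exact h0

end Uniqueness

/-! ### The `q`-Salié coefficients -/

section Salie

/-- The Hessenberg determinant that gives the `q`-Salié coefficients: the minor of `salieMatrix q α`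
with rows `m - k + 1, …, m` and columns `m - k, …, m - 1`, transposed. -/
def salieDet {R : Type*} [CommRing R] (q α : R) (m k : ℕ) : R :=
  (Matrix.of fun j i : Fin k => salieMatrix q α (m - k + i + 1) (m - k + j)).det

theorem map_salieDet {R R' : Type*} [CommRing R] [CommRing R'] (f : R →+* R') (q α : R)
    (m k : ℕ) : f (salieDet q α m k) = salieDet (f q) (f α) m k := by
  rw [salieDet, RingHom.map_det, salieDet]
  congr 1
  ext j i
  exact map_salieMatrix f q α _ _

theorem salieMatrix_self {R : Type*} [CommRing R] (q α : R) (l : ℕ) :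
    salieMatrix q α l l = 1 + q ^ l + α * (1 + q ^ (l - 1)) := by
  rw [salieMatrix, if_pos le_rfl, Nat.sub_self, powSumCoeff_zero_right, powSumCoeff_zero_right]

variable {K : Type*} [Field K]

theorem one_add_pow_ne_zero {p : K} (hp : ∀ k, 1 ≤ k → p ^ k ≠ 1) {k : ℕ} (hk : 1 ≤ k) :
    1 + p ^ k ≠ 0 := fun h => hp (2 * k) (by omega) <| by
  linear_combination (p ^ k - 1) * h

/-- The last row of the inverse of `salieMatrix` (rows and columns `1, …, m`), its entries given by
`salieDet`. -/
theorem exists_salie_row {q α : K} (hdiag : ∀ l, 1 ≤ l → salieMatrix q α l l ≠ 0) (m : ℕ) :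
    ∃ β : ℕ → K, (∀ l, 1 ≤ l → l ≤ m →
      ∑ k ∈ Icc l m, β k * salieMatrix q α k l = if l = m then 1 else 0) ∧
      ∀ k ∈ Icc 1 m, β k = (-1) ^ (m - k) * (salieDet q α m (m - k) /
        ∏ i ∈ range (m - k + 1), salieMatrix q α (m - i) (m - i)) := by
  obtain ⟨β, hβ⟩ := exists_row_of_inverse (salieMatrix q α) m hdiag
  refine ⟨β, hβ, fun k hk => ?_⟩
  rw [mem_Icc] at hk
  have h := row_of_inverse_mul_prod (fun k l hkl => by rw [salieMatrix, if_neg (by omega)]) hβ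
    (r := m - k) (by omega)
  rw [show m - (m - k) = k by omega] at h
  rw [← mul_div_assoc, eq_div_iff, h, salieDet, show m - (m - k) = k by omega]
  refine prod_ne_zero_iff.2 fun i hi => hdiag _ ?_
  rw [mem_range] at hi
  omega

theorem ratFunc_X_pow_ne_one (k : ℕ) (hk : 1 ≤ k) : (RatFunc.X : RatFunc ℚ) ^ k ≠ 1 := by
  rw [← RatFunc.algebraMap_X, ← map_pow, ← map_one (algebraMap ℚ[X] (RatFunc ℚ))]
  intro h
  have := congrArg natDegree (RatFunc.algebraMap_injective ℚ h)
  rw [natDegree_X_pow, natDegree_one] at this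
  omega

theorem aeval_ratFunc_X_pow_injective {e : ℕ} (he : 0 < e) :
    Function.Injective fun f : ℤ[X] => aeval ((RatFunc.X : RatFunc ℚ) ^ e) f := by
  have h : ∀ f : ℤ[X], aeval ((RatFunc.X : RatFunc ℚ) ^ e) f =
      algebraMap ℚ[X] (RatFunc ℚ) (expand ℚ e (f.map (Int.castRingHom ℚ))) := fun f => by
    rw [← RatFunc.algebraMap_X, ← map_pow, aeval_algebraMap_apply, expand_eq_comp_X_pow,
      aeval_def, comp, eval₂_map]
    congr 2
  intro f g hfg
  simp only [h] at hfg
  exact map_injective _ Int.cast_injective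
    (expand_injective he (RatFunc.algebraMap_injective ℚ hfg))

theorem isQSalieG_salieDet : IsQSalieG fun m k => salieDet X 0 m k := by
  intro m n hm hn p q
  have hp : ∀ k, 1 ≤ k → p ^ k ≠ 1 := ratFunc_X_pow_ne_one
  have hdiag : ∀ l, salieMatrix q 0 l l = 1 + q ^ l := fun l => by
    rw [salieMatrix_self]
    ring
  have hdiag0 : ∀ l, 1 ≤ l → salieMatrix q 0 l l ≠ 0 := fun l hl => by
    rw [hdiag, ← pow_mul]
    exact one_add_pow_ne_zero hp (by omega)
  obtain ⟨β, hβ, hβ'⟩ := exists_salie_row hdiag0 m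
  rw [altPowerSum_even hp hm hβ]
  refine sum_congr rfl fun k hk => ?_
  have h1 : aeval q (salieDet (X : ℤ[X]) 0 m (m - k)) = salieDet q 0 m (m - k) := by
    have := map_salieDet (aeval q : ℤ[X] →ₐ[ℤ] RatFunc ℚ).toRingHom X 0 m (m - k)
    simpa using this
  rw [hβ' k hk, h1, neg_pow (q ^ n)]
  simp only [hdiag]
  ring

theorem isQSalieH_salieDet : IsQSalieH fun m k => salieDet (X ^ 2) X m k := by
  intro m n hm hn p q
  have hp : ∀ k, 1 ≤ k → p ^ k ≠ 1 := ratFunc_X_pow_ne_one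
  have hdiag : ∀ l, 1 ≤ l → salieMatrix q p l l = (1 + p) * (1 + p ^ (2 * l - 1)) := fun l hl => by
    obtain ⟨l, rfl⟩ := Nat.exists_eq_add_of_le' hl
    rw [salieMatrix_self, Nat.add_sub_cancel, show 2 * (l + 1) - 1 = 2 * l + 1 by omega]
    simp only [q]
    ring
  have hdiag0 : ∀ l, 1 ≤ l → salieMatrix q p l l ≠ 0 := fun l hl => by
    rw [hdiag l hl]
    refine mul_ne_zero ?_ (one_add_pow_ne_zero hp (by omega))
    simpa using one_add_pow_ne_zero hp le_rfl
  obtain ⟨β, hβ, hβ'⟩ := exists_salie_row hdiag0 m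
  have h1 : ∀ k, aeval p (salieDet (X ^ 2 : ℤ[X]) X m k) = salieDet q p m k := fun k => by
    have := map_salieDet (aeval p : ℤ[X] →ₐ[ℤ] RatFunc ℚ).toRingHom (X ^ 2) X m k
    simpa using this
  have h2 : ∀ k ∈ Icc 1 m, β k = (-1) ^ (m - k) * (salieDet q p m (m - k) /
      ((1 + p) ^ (m - k + 1) * ∏ i ∈ range (m - k + 1), (1 + p ^ (2 * (m - i) - 1)))) :=
    fun k hk => by
      rw [hβ' k hk, prod_congr rfl fun i hi => hdiag (m - i) (by
        rw [mem_Icc] at hk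
        rw [mem_range] at hi
        omega), prod_mul_distrib, prod_const, card_range]
  simp only [h1]
  rw [altPowerSum_odd hp hm hβ, h2 1 (by simpa using hm), Nat.sub_add_cancel hm]
  congr 1
  · obtain ⟨m, rfl⟩ := Nat.exists_eq_add_of_le' hm
    rw [Nat.add_sub_cancel, pow_add (-1) (m + 1) n]
    ring
  · congr 1
    refine sum_congr rfl fun k hk => ?_
    rw [h2 k hk, neg_pow (q ^ n)]
    ring

theorem IsQSalieG.unique {G G' : ℕ → ℕ → ℤ[X]} (hG : IsQSalieG G) (hG' : IsQSalieG G') {m k : ℕ}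
    (hk : k < m) : G m k = G' m k := by
  set p : RatFunc ℚ := RatFunc.X
  have hp : ∀ k, 1 ≤ k → p ^ k ≠ 1 := ratFunc_X_pow_ne_one
  have hq : ∀ k, 1 ≤ k → (p ^ 2) ^ k ≠ 1 := fun k hk => by
    rw [← pow_mul]
    exact hp _ (by omega)
  have key := even_coeff_eq_zero (q := p ^ 2) (pow_ne_zero 2 RatFunc.X_ne_zero) hq (m := m)
    (d := fun k => (aeval (p ^ 2) (G m (m - k)) - aeval (p ^ 2) (G' m (m - k))) /
      ∏ i ∈ range (m - k + 1), (1 + (p ^ 2) ^ (m - i))) (fun n hn => by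
        have h := (hG m n (by omega) hn).symm.trans (hG' m n (by omega) hn)
        have hA : qInt (p ^ 2) n * qInt (p ^ 2) (n + 1) ≠ 0 :=
          mul_ne_zero (qInt_sq_ne_zero hp hn) (qInt_sq_ne_zero hp (by omega))
        refine mul_left_cancel₀ hA ?_
        rw [mul_zero, ← sub_eq_zero.2 h, ← sum_sub_distrib, mul_sum]
        refine sum_congr rfl fun k hk => ?_
        rw [mem_Icc] at hk
        obtain ⟨k, rfl⟩ := Nat.exists_eq_add_of_le' hk.1
        rw [Nat.add_sub_cancel, pow_succ _ k, sub_div]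
        ring) (m - k) (by rw [mem_Icc]; omega)
  rw [show m - (m - k) = k by omega, div_eq_zero_iff, or_iff_left, sub_eq_zero] at key
  · exact aeval_ratFunc_X_pow_injective two_pos key
  · refine prod_ne_zero_iff.2 fun i hi => ?_
    rw [mem_range] at hi
    exact one_add_pow_ne_zero hq (by omega)

theorem IsQSalieH.unique {H H' : ℕ → ℕ → ℤ[X]} (hH : IsQSalieH H) (hH' : IsQSalieH H') {m k : ℕ}
    (hk : k < m) : H m k = H' m k := by
  set p : RatFunc ℚ := RatFunc.X
  have hp : ∀ k, 1 ≤ k → p ^ k ≠ 1 := ratFunc_X_pow_ne_one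
  have key := odd_coeff_eq_zero (p := p) RatFunc.X_ne_zero hp (m := m) (by omega)
    (d := fun k => (aeval p (H m (m - k)) - aeval p (H' m (m - k))) /
      ((1 + p) ^ (m - k + 1) * ∏ i ∈ range (m - k + 1), (1 + p ^ (2 * (m - i) - 1))))
    (e := (-1) ^ m * (aeval p (H m (m - 1)) - aeval p (H' m (m - 1))) /
      ((1 + p) ^ m * ∏ i ∈ range m, (1 + p ^ (2 * (m - i) - 1)))) (fun n hn => by
        have h := sub_eq_zero.2 ((hH m n (by omega) hn).symm.trans (hH' m n (by omega) hn))
        rw [add_sub_add_comm, ← mul_sub, ← sum_sub_distrib] at h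
        rw [← h]
        congr 1
        · rw [pow_add]
          ring
        · congr 1
          refine sum_congr rfl fun k hk => ?_
          rw [sub_div]
          ring) (m - k) (by rw [mem_Icc]; omega)
  rw [show m - (m - k) = k by omega, div_eq_zero_iff, or_iff_left, sub_eq_zero] at key
  · refine aeval_ratFunc_X_pow_injective one_pos ?_
    simpa using key
  · refine mul_ne_zero (pow_ne_zero _ ?_) (prod_ne_zero_iff.2 fun i hi => ?_)
    · simpa using one_add_pow_ne_zero hp le_rfl
    · rw [mem_range] at hi
      exact one_add_pow_ne_zero hp (by omega)

end Salie

open Classical in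
theorem mainTheorem2 :
    (∃ G : ℕ → ℕ → ℤ[X], IsQSalieG G) ∧
    (∃ H : ℕ → ℕ → ℤ[X], IsQSalieH H) ∧
    (∀ G : ℕ → ℕ → ℤ[X], IsQSalieG G → ∀ m k : ℕ, k < m →
      G m k = ∑ L : PathFamily m k with L.NonIntersecting,
        ∑ I ∈ (Finset.Ico (0 : ℤ) k).powerset, L.weight (stepWeight (X : ℤ[X]) I)) ∧
    (∀ H : ℕ → ℕ → ℤ[X], IsQSalieH H → ∀ m k : ℕ, k < m →
      H m k = ∑ L : PathFamily m k with L.NonIntersecting,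
        ∑ I ∈ (Finset.Ico (0 : ℤ) k).powerset, L.weight (stepWeightBar k (X : ℤ[X]) I)) := by
  refine ⟨⟨_, isQSalieG_salieDet⟩, ⟨_, isQSalieH_salieDet⟩, fun G hG m k hk => ?_,
    fun H hH m k hk => ?_⟩
  · rw [hG.unique isQSalieG_salieDet hk, salieDet, ← sum_pathFamily_eq_det hk]
    have : shiftedWeight k (X : ℤ[X]) 0 = stepWeight X := by
      funext I s t
      simp [shiftedWeight]
    rw [this]
  · rw [hH.unique isQSalieH_salieDet hk, salieDet, ← sum_pathFamily_eq_det hk]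
    rfl
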